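/- **Setting.** Let $\Omega=\prod_{i=1}^m[a_i,b_i]\subset\mathbb R^m$ ($a_i<b_i$) be a box, let $\{\phi_n\}_{n\ge1}$ enumerate its periodic Fourier modes, $\phi_n(x)=e^{i\omega_n\cdot x}$, where $\omega_n$ runs once through all vectors with coordinates $2\pi k_i/(b_i-a_i)$, $k\in\mathbb Z^m$, and let $d_n>0$. Let $\mathcal H(d)=\{\sum_n d_n^{-1/2}b_n\phi_n : b\in\ell^2\}$ with norm $\|\sum_n d_n^{-1/2}b_n\phi_n\|_d=\|b\|_{\ell^2}$. Let $S^{(1)},\dots,S^{(N_S)}\subset\Omega$ and let $\mathcal F^{(i)}=\sum_{|\alpha|\le p}c^{(i)}_\alpha\partial^\alpha$ be linear differential operators of order at most $p$; assume $\{\|\omega_n\|_2^p d_n^{-1/2}\}_n\in\ell^2$. Given data $f^{(i)}$ on $S^{(i)}$ and finite point clouds $X^{(i)}\subset S^{(i)}$, let $\tilde b$ minimize $\|b\|_{\ell^2}$ over all $b\in\ell^2$ with $\sum_n d_n^{-1/2}b_n(\mathcal F^{(i)}\phi_n)(x)=f^{(i)}(x)$ for all $i$ and all $x\in X^{(i)}$,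 and put $\tilde u=\sum_n d_n^{-1/2}\tilde b_n\phi_n$ (the minimal-norm interpolant). Let $h_{\max}=\max_i\sup_{x\in S^{(i)}}\min_{z\in X^{(i)}}\|x-z\|_2$. **Assumptions on one domain.** Fix $j$ and integers $q\ge1$, $m_j\ge1$. Assume: 1. $\overline{S^{(j)}}$ is contained in an $m_j$-dimensional embedded $C^1$ submanifold of $\mathbb R^m$ without boundary (for example: $S^{(j)}$ is a compact embedded manifold, or a relatively compact piece of an embedded manifold, or, for $m_j=m$, any open set). 2. There are finitely many injective $C^q$ charts $\sigma_k:U_k\to S^{(j)}$, $k=1,\dots,M$, whose domains $U_k\subset\mathbb R^{m_j}$ are open and satisfy an interior cone condition, whose derivatives up to order $q$ are bounded on $U_k$, whose inverse metric tensors exist and are bounded on $U_k$, and whose images cover $S^{(j)}$, up to points in the closure of their union. 3. The coefficients $c^{(j)}_\alpha$ are $C^q$ in a neighbourhood of $S^{(j)}$, and $F^{(j,q)}d^{-1/2}\in\ell^2$, where $F^{(j,q)}_n=\max_{|\beta|\le q}\sup_{S^{(j)}}|\partial^\beta\mathcal F^{(j)}\phi_n|$. **Proposition 3.3.** There are $h_0>0$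 and constants $B_{k,\ell}>0$ ($1\le k\le M$, $\ell\ge0$) and $B'>0$, independent of the point clouds, of the data $f^{(i)}$ and of $u$, such that whenever $h_{\max}\le h_0$ and $u\in\mathcal H(d)$ solves $\mathcal F^{(i)}u|_{S^{(i)}}=f^{(i)}$ for all $i$, the function $(\mathcal F^{(j)}\tilde u-f^{(j)})\circ\sigma_k$ is $C^q$ on $U_k$ for each $k$ and, for every multi-index $\alpha$ with $|\alpha|\le q$, $$\bigl\|\partial^\alpha\bigl((\mathcal F^{(j)}\tilde u-f^{(j)})\circ\sigma_k\bigr)\bigr\|_{L^\infty(U_k)}\le B_{k,|\alpha|}\,h_{\max}^{\,q-m_j/2-|\alpha|}\,\|u\|_d .$$ In particular, $\|\mathcal F^{(j)}\tilde u-f^{(j)}\|_{L^\infty(S^{(j)})}\le B'\,h_{\max}^{\,q-m_j/2}\,\|u\|_d$. -/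

import Mathlib

open scoped ENNReal

namespace HBExt

/-- `ℝⁿ` with the Euclidean norm. -/
abbrev Euc (n : ℕ) : Type := EuclideanSpace ℝ (Fin n)

/-- The multi-indices `α ∈ ℕⁿ` with `|α| ≤ p`. -/
def multiIdx (n p : ℕ) : Finset (Fin n → ℕ) :=
  {α ∈ Fintype.piFinset (fun _ : Fin n => Finset.range (p + 1)) | ∑ i, α i ≤ p}

theorem mem_multiIdx {n p : ℕ} {α : Fin n → ℕ} : α ∈ multiIdx n p ↔ ∑ i, α i ≤ p := by
  unfold multiIdx
  simp only [Finset.mem_filter, Fintype.mem_piFinset, Finset.mem_range, and_iff_right_iff_imp]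
  intro h i
  have := Finset.single_le_sum (f := α) (fun _ _ => Nat.zero_le _) (Finset.mem_univ i)
  omega

/-- The partial derivative `∂ᵢ f`. -/
noncomputable def pderiv {n : ℕ} (i : Fin n) (f : Euc n → ℂ) : Euc n → ℂ :=
  fun x => fderiv ℝ f x (EuclideanSpace.single i 1)

/-- The partial derivative `∂^α f = ∂₁^{α₁} ⋯ ∂ₙ^{αₙ} f`. -/
noncomputable def multiDeriv {n : ℕ} (α : Fin n → ℕ) (f : Euc n → ℂ) : Euc n → ℂ :=
  (List.finRange n).foldr (fun i g => (pderiv i)^[α i] g) f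

/-- The linear differential operator `∑_{|α| ≤ p} c_α ∂^α`, applied to `u`. -/
noncomputable def diffOp {m : ℕ} (p : ℕ) (c : (Fin m → ℕ) → Euc m → ℂ) (u : Euc m → ℂ) :
    Euc m → ℂ :=
  fun x => ∑ α ∈ multiIdx m p, c α x * multiDeriv α u x

/-- The closed box with corners `lo` and `hi`. -/
def box {m : ℕ} (lo hi : Fin m → ℝ) : Set (Euc m) :=
  {x | ∀ i, lo i ≤ x i ∧ x i ≤ hi i}

/-- The frequency `ωₙ` of the `n`-th periodic Fourier mode of the box, where the
enumeration `e` lists the integer lattice. -/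
noncomputable def freq {m : ℕ} (lo hi : Fin m → ℝ) (e : ℕ ≃ (Fin m → ℤ)) (n : ℕ) : Euc m :=
  WithLp.toLp 2 (fun i => 2 * Real.pi * (e n i : ℝ) / (hi i - lo i))

/-- The complex exponential `x ↦ exp(i ω·x)`. -/
noncomputable def mode {m : ℕ} (ω : Euc m) : Euc m → ℂ :=
  fun x => Complex.exp (Complex.I * ((inner ℝ ω x : ℝ) : ℂ))

/-- `d_n^{-1/2}`. -/
noncomputable def wt (d : ℕ → ℝ) (n : ℕ) : ℝ := (d n) ^ (-(1 / 2) : ℝ)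

/-- The element `∑ d_n^{-1/2} b_n φ_n` of the native space `H(d)`, for `b ∈ ℓ²`.
Its `d`-norm is by definition the `ℓ²` norm of `b`. -/
noncomputable def synth {m : ℕ} (ω : ℕ → Euc m) (d : ℕ → ℝ) (b : lp (fun _ : ℕ => ℂ) 2) :
    Euc m → ℂ :=
  fun x => ∑' n, (wt d n : ℂ) * b n * mode (ω n) x

/-- The Hermite-Birkhoff interpolation conditions
`∑ d_n^{-1/2} b_n (F^{(i)} φ_n)(x) = f^{(i)}(x)` for all `i` and all `x` in the `i`-th cloud. -/
def Feasible {m N : ℕ} (ω : ℕ → Euc m) (d : ℕ → ℝ) (p : ℕ)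
    (c : Fin N → (Fin m → ℕ) → Euc m → ℂ) (X : Fin N → Finset (Euc m))
    (f : Fin N → Euc m → ℂ) (b : lp (fun _ : ℕ => ℂ) 2) : Prop :=
  ∀ i, ∀ x ∈ X i, ∑' n, (wt d n : ℂ) * b n * diffOp p (c i) (mode (ω n)) x = f i x

/-- `b` solves the norm minimization problem over the feasible sequences of `ℓ²`. -/
def IsMinNorm {m N : ℕ} (ω : ℕ → Euc m) (d : ℕ → ℝ) (p : ℕ)
    (c : Fin N → (Fin m → ℕ) → Euc m → ℂ) (X : Fin N → Finset (Euc m))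
    (f : Fin N → Euc m → ℂ) (b : lp (fun _ : ℕ => ℂ) 2) : Prop :=
  Feasible ω d p c X f b ∧ ∀ b', Feasible ω d p c X f b' → ‖b‖ ≤ ‖b'‖

/-- The fill distance of the finite set `X` in `S`, for the Euclidean distance
(infinite if `X` is empty and `S` is not). -/
noncomputable def fillDist {m : ℕ} (S : Set (Euc m)) (X : Finset (Euc m)) : ℝ≥0∞ :=
  ⨆ x ∈ S, ⨅ z ∈ X, edist x z

/-- The largest of the fill distances of the point clouds in their domains. -/
noncomputable def hmax {m N : ℕ} (S : Fin N → Set (Euc m)) (X : Fin N → Finset (Euc m)) : ℝ≥0∞ :=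
  ⨆ i, fillDist (S i) (X i)

/-- `max_{|β| ≤ q} sup_S |∂^β g|`, with values in `[0, ∞]`. -/
noncomputable def derivSup {m : ℕ} (q : ℕ) (S : Set (Euc m)) (g : Euc m → ℂ) : ℝ≥0∞ :=
  ⨆ β ∈ multiIdx m q, ⨆ x ∈ S, ‖multiDeriv β g x‖ₑ

/-- The interior cone condition. -/
def InteriorCone {n : ℕ} (U : Set (Euc n)) : Prop :=
  ∃ θ r : ℝ, 0 < θ ∧ θ < Real.pi / 2 ∧ 0 < r ∧ ∀ x ∈ U, ∃ ξ : Euc n, ‖ξ‖ = 1 ∧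
    ∀ y : Euc n, ‖y‖ = 1 → Real.cos θ ≤ inner ℝ y ξ → ∀ t ∈ Set.Icc 0 r, x + t • y ∈ U

/-- `M` is a `k`-dimensional embedded `C¹` submanifold (without boundary) of `ℝᵐ`: near each of its
points it is carried to the slice `ℝᵏ × {0}` by a `C¹` diffeomorphism between open sets of `ℝᵐ`. -/
def IsSubmanifold {m : ℕ} (k : ℕ) (M : Set (Euc m)) : Prop :=
  ∀ x ∈ M, ∃ Φ : OpenPartialHomeomorph (Euc m) (Euc m), x ∈ Φ.source ∧
    ContDiffOn ℝ 1 Φ Φ.source ∧ ContDiffOn ℝ 1 Φ.symm Φ.target ∧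
    ∀ z ∈ Φ.source, z ∈ M ↔ ∀ i : Fin m, k ≤ (i : ℕ) → Φ z i = 0

/-- The metric tensor `g_{ab} = ∂_a σ · ∂_b σ` of a parametrization. -/
noncomputable def metricTensor {k m : ℕ} (σ : Euc k → Euc m) (y : Euc k) :
    Matrix (Fin k) (Fin k) ℝ :=
  Matrix.of fun a b => inner ℝ (fderiv ℝ σ y (EuclideanSpace.single a 1))
    (fderiv ℝ σ y (EuclideanSpace.single b 1))

/-- `σ : U → S` is a local parametrization of class `C^q`, with derivatives bounded up to order `q`,
with a bounded inverse metric tensor, and with a domain that satisfies an interior cone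
condition. -/
structure IsChart {k m : ℕ} (q : ℕ) (S : Set (Euc m)) (U : Set (Euc k)) (σ : Euc k → Euc m) :
    Prop where
  isOpen : IsOpen U
  cone : InteriorCone U
  mapsTo : Set.MapsTo σ U S
  injOn : Set.InjOn σ U
  contDiffOn : ContDiffOn ℝ q σ U
  bounded : ∃ A : ℝ, ∀ l ≤ q, ∀ y ∈ U, ‖iteratedFDeriv ℝ l σ y‖ ≤ A
  metric : ∃ A : ℝ, ∀ y ∈ U, (metricTensor σ y).det ≠ 0 ∧
    ∀ a b, |(metricTensor σ y)⁻¹ a b| ≤ A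

end HBExt

/-!
The residual `F ũ - f` on the `j`-th domain is `F (ũ - u)`, hence the series
`∑ d_n^{-1/2} (b'_n - b_n) F φ_n` (`hasSum_diffOp_synth`), where `‖b' - b‖ ≤ 2 ‖b‖` because the
coefficients of `u` are feasible for the minimization problem. It vanishes on the point cloud.
Since `F^{(j,q)} d^{-1/2}` is square-summable, the Cauchy–Schwarz inequality and the bound on
derivatives of compositions show that its pull-back by a chart is `C^q`, with derivatives up to
order `q` bounded in the supremum norm by a multiple of `‖b‖` (`IsChart.exists_series_bound`).

Two facts turn zeros into smallness.

* Every ball of radius `C h` inside a chart domain contains a zero of the pull-back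
  (`IsChart.exists_mem_ball_eq`). A point of the cloud at distance at most `h` from the image of
  the centre need not obviously be in the image of that chart. It is, because it lies on the
  submanifold: in flattening coordinates, uniform over the compact closure of the domain, the chart
  becomes a map between spaces of equal dimension whose derivative is invertible with a uniform
  bound, and such a map sends a ball onto a set containing a proportional ball
  (`exists_mem_ball_eq_of_fderiv`). For `q = 1` the derivative of the chart has no modulus of
  continuity, so the quantitative inverse function theorem is replaced by a minimization argument
  which needs only the bound on the inverse.
* A `C^q` function with such zeros has partial derivatives of order `l` of size `O(h^{q-l})`
  (`norm_multiDeriv_le_of_zeros`). In a cone of height proportional to `h` the Taylor polynomial of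
  degree `q - 1` is `O(h^q)` at the zeros, and the zeros form a norming set for polynomials, with
  constants made uniform over the directions of the cones by compactness
  (`exists_ball_le_norm_polyVal`).

The derivatives being bounded in the supremum norm, the rate obtained is `h^{q-l}`, which for
`h ≤ 1` is at least as good as `h^{q-m_j/2-l}`. The bound on the whole domain follows by continuity
of the residual from the covering assumption.
-/

namespace HBExt

/-! ### Iterated partial derivatives -/

/-- The iterated partial derivative along a list of coordinate directions, the head of the list
being applied last. -/
noncomputable def listDeriv {n : ℕ} (L : List (Fin n)) (f : Euc n → ℂ) : Euc n → ℂ :=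
  L.foldr pderiv f

theorem listDeriv_cons {n : ℕ} (i : Fin n) (L : List (Fin n)) (f : Euc n → ℂ) :
    listDeriv (i :: L) f = pderiv i (listDeriv L f) := rfl

theorem listDeriv_append {n : ℕ} (L L' : List (Fin n)) (f : Euc n → ℂ) :
    listDeriv (L ++ L') f = listDeriv L (listDeriv L' f) := by
  simp [listDeriv, List.foldr_append]

theorem listDeriv_replicate {n : ℕ} (i : Fin n) (k : ℕ) (f : Euc n → ℂ) :
    listDeriv (List.replicate k i) f = (pderiv i)^[k] f := by
  induction k with
  | zero => rfl
  | succ k ih =>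
    rw [List.replicate_succ, listDeriv_cons, ih, Function.iterate_succ_apply']

/-- The list of directions in which `multiDeriv α` differentiates. -/
def multiList {n : ℕ} (α : Fin n → ℕ) : List (Fin n) :=
  (List.finRange n).flatMap fun i => List.replicate (α i) i

theorem multiDeriv_eq_listDeriv {n : ℕ} (α : Fin n → ℕ) (f : Euc n → ℂ) :
    multiDeriv α f = listDeriv (multiList α) f := by
  unfold multiDeriv multiList
  induction List.finRange n with
  | nil => rfl
  | cons i L ih =>
    rw [List.foldr_cons, ih, List.flatMap_cons, listDeriv_append, listDeriv_replicate]

theorem count_multiList {n : ℕ} (α : Fin n → ℕ) (j : Fin n) :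
    (multiList α).count j = α j := by
  unfold multiList
  rw [List.count_flatMap]
  have h : (List.map (List.count j ∘ fun i => List.replicate (α i) i) (List.finRange n)).sum
      = ∑ i, if i = j then α i else 0 := by
    rw [Fin.sum_univ_def]
    congr 1
    refine List.map_congr_left fun i _ => ?_
    simp [List.count_replicate]
  rw [h]
  simp

theorem length_multiList {n : ℕ} (α : Fin n → ℕ) : (multiList α).length = ∑ i, α i := by
  unfold multiList
  rw [List.length_flatMap, Fin.sum_univ_def]
  simp

theorem contDiffOn_pderiv {n r : ℕ} {V : Set (Euc n)} (hV : IsOpen V) {f : Euc n → ℂ}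
    (hf : ContDiffOn ℝ ((r + 1 : ℕ) : WithTop ℕ∞) f V) (i : Fin n) :
    ContDiffOn ℝ r (pderiv i f) V := by
  have h := hf.fderiv_of_isOpen (m := r) hV (by norm_cast)
  exact h.clm_apply contDiffOn_const

theorem contDiffOn_listDeriv {n : ℕ} {V : Set (Euc n)} (hV : IsOpen V) {f : Euc n → ℂ}
    (L : List (Fin n)) {r : ℕ} (hf : ContDiffOn ℝ ((r + L.length : ℕ) : WithTop ℕ∞) f V) :
    ContDiffOn ℝ r (listDeriv L f) V := by
  induction L generalizing r with
  | nil => simpa [listDeriv] using hf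
  | cons i L ih =>
    rw [listDeriv_cons]
    refine contDiffOn_pderiv hV (ih ?_) i
    convert hf using 2
    simp only [List.length_cons]
    omega

theorem pderiv_congr {n : ℕ} {V : Set (Euc n)} (hV : IsOpen V) {f g : Euc n → ℂ}
    (h : Set.EqOn f g V) (i : Fin n) : Set.EqOn (pderiv i f) (pderiv i g) V := by
  intro x hx
  unfold pderiv
  rw [(h.eventuallyEq_of_mem (hV.mem_nhds hx)).fderiv_eq]

theorem listDeriv_congr {n : ℕ} {V : Set (Euc n)} (hV : IsOpen V) {f g : Euc n → ℂ}
    (h : Set.EqOn f g V) (L : List (Fin n)) : Set.EqOn (listDeriv L f) (listDeriv L g) V := by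
  induction L with
  | nil => exact h
  | cons i L ih => exact pderiv_congr hV ih i

theorem multiDeriv_congr {n : ℕ} {V : Set (Euc n)} (hV : IsOpen V) {f g : Euc n → ℂ}
    (h : Set.EqOn f g V) (α : Fin n → ℕ) : Set.EqOn (multiDeriv α f) (multiDeriv α g) V := by
  simpa only [multiDeriv_eq_listDeriv] using listDeriv_congr hV h _

theorem multiDeriv_zero {n : ℕ} (f : Euc n → ℂ) : multiDeriv 0 f = f := by
  rw [multiDeriv_eq_listDeriv, List.eq_nil_of_length_eq_zero (l := multiList 0)]
  · rfl
  · simp [length_multiList]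

theorem pderiv_comm {n : ℕ} {V : Set (Euc n)} (hV : IsOpen V) {f : Euc n → ℂ}
    (hf : ContDiffOn ℝ 2 f V) (i j : Fin n) :
    Set.EqOn (pderiv i (pderiv j f)) (pderiv j (pderiv i f)) V := by
  intro x hx
  have hfx : ContDiffAt ℝ 2 f x := hf.contDiffAt (hV.mem_nhds hx)
  have hs := hfx.isSymmSndFDerivAt (by simp)
  have hd : DifferentiableAt ℝ (fderiv ℝ f) x :=
    (hfx.fderiv_right (m := 1) (by norm_num)).differentiableAt (by norm_num)
  have key : ∀ v w : Euc n, fderiv ℝ (fun z => fderiv ℝ f z v) x w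
      = fderiv ℝ (fderiv ℝ f) x w v := by
    intro v w
    rw [fderiv_clm_apply hd (differentiableAt_const _)]
    simp
  unfold pderiv
  rw [key, key]
  exact hs.eq _ _

/-- Partial derivatives of a `C^r` function may be taken in any order. -/
theorem listDeriv_perm {n : ℕ} {V : Set (Euc n)} (hV : IsOpen V) {f : Euc n → ℂ}
    {L L' : List (Fin n)} (hL : L.Perm L') (hf : ContDiffOn ℝ L.length f V) :
    Set.EqOn (listDeriv L f) (listDeriv L' f) V := by
  induction hL with
  | nil => exact fun _ _ => rfl
  | cons i _ ih =>
    exact pderiv_congr hV (ih (hf.of_le (by simp))) i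
  | swap i j L =>
    refine pderiv_comm hV (contDiffOn_listDeriv (r := 2) hV L ?_) j i
    convert hf using 2
    simp only [List.length_cons]
    omega
  | trans h₁ _ ih₁ ih₂ => exact (ih₁ hf).trans (ih₂ (h₁.length_eq ▸ hf))

theorem iteratedFDeriv_single {n l : ℕ} {V : Set (Euc n)} (hV : IsOpen V) {f : Euc n → ℂ}
    (hf : ContDiffOn ℝ l f V) (i : Fin l → Fin n) {x : Euc n} (hx : x ∈ V) :
    iteratedFDeriv ℝ l f x (fun k => EuclideanSpace.single (i k) (1 : ℝ))
      = listDeriv (List.ofFn i) f x := by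
  induction l generalizing x with
  | zero => simp [listDeriv]
  | succ l ih =>
    rw [iteratedFDeriv_succ_apply_left, List.ofFn_succ, listDeriv_cons]
    have hd : DifferentiableAt ℝ (iteratedFDeriv ℝ l f) x :=
      (hf.contDiffAt (hV.mem_nhds hx)).differentiableAt_iteratedFDeriv
        (by exact_mod_cast Nat.lt_succ_self l)
    have he : listDeriv (List.ofFn fun k : Fin l => i k.succ) f =ᶠ[nhds x]
        fun z => iteratedFDeriv ℝ l f z
          (fun k => EuclideanSpace.single (i k.succ) (1 : ℝ)) := by
      filter_upwards [hV.mem_nhds hx] with z hz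
      exact (ih (hf.of_le (by exact_mod_cast Nat.le_succ l)) _ hz).symm
    unfold pderiv
    rw [he.fderiv_eq, (hd.hasFDerivAt.continuousMultilinear_apply_const _).fderiv]
    rfl

/-- The multi-index counting how often each direction occurs in `i`. -/
def occ {n l : ℕ} (i : Fin l → Fin n) (j : Fin n) : ℕ := (List.ofFn i).count j

theorem sum_occ {n l : ℕ} (i : Fin l → Fin n) : ∑ j, occ i j = l := by
  have h := Multiset.toFinset_sum_count_eq (Multiset.ofList (List.ofFn i))
  simp only [Multiset.coe_card, List.length_ofFn, Multiset.coe_count] at h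
  refine Eq.trans (Finset.sum_subset (Finset.subset_univ _) ?_).symm h
  intro j _ hj
  change List.count j (List.ofFn i) = 0
  rw [List.count_eq_zero]
  intro hm
  exact hj (by simpa using hm)

theorem prod_comp_eq_prod_pow_occ {n l : ℕ} {R : Type*} [CommMonoid R] (v : Fin n → R)
    (i : Fin l → Fin n) : ∏ k, v (i k) = ∏ j, v j ^ occ i j := by
  have h := Finset.prod_multiset_map_count (Multiset.ofList (List.ofFn i)) v
  have h1 : (Multiset.map v (Multiset.ofList (List.ofFn i))).prod = ∏ k, v (i k) := by
    rw [Multiset.map_coe, Multiset.prod_coe, List.map_ofFn, List.prod_ofFn]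
    simp
  simp only [Multiset.coe_count] at h
  rw [← h1, h]
  refine Finset.prod_subset (s₂ := Finset.univ) (f := fun j => v j ^ occ i j)
    (Finset.subset_univ _) ?_
  intro j _ hj
  have : (List.ofFn i).count j = 0 := by
    rw [List.count_eq_zero]
    intro hm
    exact hj (by simpa using hm)
  simp [occ, this]

theorem exists_occ_eq {n l : ℕ} {α : Fin n → ℕ} (h : ∑ j, α j = l) :
    ∃ i : Fin l → Fin n, occ i = α := by
  subst h
  rw [← length_multiList]
  refine ⟨(multiList α).get, funext fun j => ?_⟩
  unfold occ
  rw [List.ofFn_get, count_multiList]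

/-- The value of the `l`-th derivative on coordinate vectors is the partial derivative given by
the multi-index of their directions. -/
theorem iteratedFDeriv_single_eq_multiDeriv {n l : ℕ} {V : Set (Euc n)} (hV : IsOpen V)
    {f : Euc n → ℂ} (hf : ContDiffOn ℝ l f V) (i : Fin l → Fin n) {x : Euc n} (hx : x ∈ V) :
    iteratedFDeriv ℝ l f x (fun k => EuclideanSpace.single (i k) (1 : ℝ))
      = multiDeriv (occ i) f x := by
  rw [iteratedFDeriv_single hV hf i hx, multiDeriv_eq_listDeriv]
  refine listDeriv_perm hV ?_ (by simpa using hf) hx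
  rw [List.perm_iff_count]
  intro j
  rw [count_multiList]
  rfl

theorem iteratedFDeriv_apply_eq_sum {n l : ℕ} {V : Set (Euc n)} (hV : IsOpen V)
    {f : Euc n → ℂ} (hf : ContDiffOn ℝ l f V) {x : Euc n} (hx : x ∈ V) (v : Fin l → Euc n) :
    iteratedFDeriv ℝ l f x v
      = ∑ i : Fin l → Fin n, ((∏ k, v k (i k) : ℝ) : ℂ) * multiDeriv (occ i) f x := by
  have hv : v = fun k => ∑ j, v k j • EuclideanSpace.single j (1 : ℝ) := by
    funext k
    ext j
    simp [Finset.sum_apply, Pi.single_apply]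
  conv_lhs => rw [hv]
  rw [ContinuousMultilinearMap.map_sum]
  refine Finset.sum_congr rfl fun i _ => ?_
  rw [ContinuousMultilinearMap.map_smul_univ, iteratedFDeriv_single_eq_multiDeriv hV hf i hx,
    Complex.real_smul]

theorem norm_iteratedFDeriv_le_of_multiDeriv {n l : ℕ} {V : Set (Euc n)} (hV : IsOpen V)
    {f : Euc n → ℂ} (hf : ContDiffOn ℝ l f V) {x : Euc n} (hx : x ∈ V) {D : ℝ}
    (hD : ∀ α : Fin n → ℕ, ∑ j, α j = l → ‖multiDeriv α f x‖ ≤ D) :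
    ‖iteratedFDeriv ℝ l f x‖ ≤ (n : ℝ) ^ l * D := by
  by_cases hne : Nonempty (Fin l → Fin n)
  · have hD0 : 0 ≤ D := (norm_nonneg _).trans (hD _ (sum_occ hne.some))
    refine ContinuousMultilinearMap.opNorm_le_bound (by positivity) fun v => ?_
    rw [iteratedFDeriv_apply_eq_sum hV hf hx]
    calc _ ≤ ∑ i : Fin l → Fin n, (∏ k, ‖v k‖) * D := by
          refine norm_sum_le_of_le _ fun i _ => ?_
          rw [norm_mul, Complex.norm_real, norm_prod]
          gcongr with k
          · exact PiLp.norm_apply_le _ _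
          · exact hD _ (sum_occ i)
      _ = _ := by
          simp [Finset.sum_const, Fintype.card_pi]
          ring
  · have : IsEmpty (Fin l → Fin n) := not_nonempty_iff.mp hne
    obtain rfl : n = 0 := by
      by_contra h0
      exact hne ⟨fun _ => ⟨0, Nat.pos_of_ne_zero h0⟩⟩
    have hl : l ≠ 0 := by
      rintro rfl
      exact hne ⟨Fin.elim0⟩
    have : ‖iteratedFDeriv ℝ l f x‖ ≤ 0 := by
      refine ContinuousMultilinearMap.opNorm_le_bound le_rfl fun v => ?_
      rw [iteratedFDeriv_apply_eq_sum hV hf hx, Fintype.sum_empty]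
      simp
    simpa [hl] using this

theorem norm_multiDeriv_le {n l : ℕ} {V : Set (Euc n)} (hV : IsOpen V)
    {f : Euc n → ℂ} (hf : ContDiffOn ℝ l f V) {x : Euc n} (hx : x ∈ V) {α : Fin n → ℕ}
    (hα : ∑ j, α j = l) : ‖multiDeriv α f x‖ ≤ ‖iteratedFDeriv ℝ l f x‖ := by
  obtain ⟨i, rfl⟩ := exists_occ_eq hα
  rw [← iteratedFDeriv_single_eq_multiDeriv hV hf i hx]
  refine (ContinuousMultilinearMap.le_opNorm _ _).trans ?_
  simp

/-! ### Polynomials and norming sets -/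

/-- The polynomial of degree at most `r` with complex coefficients `a`, evaluated at the real
vector `v`. -/
noncomputable def polyVal {n r : ℕ} (a : multiIdx n r → ℂ) (v : Euc n) : ℂ :=
  ∑ α, a α * ∏ j, (v j : ℂ) ^ α.1 j

theorem polyVal_smul {n r : ℕ} (t : ℂ) (a : multiIdx n r → ℂ) (v : Euc n) :
    polyVal (t • a) v = t * polyVal a v := by
  simp [polyVal, Finset.mul_sum, mul_assoc]

theorem continuous_polyVal {n r : ℕ} :
    Continuous fun x : (multiIdx n r → ℂ) × Euc n => polyVal x.1 x.2 := by
  unfold polyVal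
  refine continuous_finsetSum _ fun α _ => ?_
  refine ((continuous_apply α).comp continuous_fst).mul ?_
  refine continuous_finsetProd _ fun j _ => ?_
  exact (Complex.continuous_ofReal.comp ((EuclideanSpace.proj j).continuous.comp
    continuous_snd)).pow _

/-- A nonzero polynomial does not vanish identically on a nonempty open set. -/
theorem exists_polyVal_ne_zero {n r : ℕ} {a : multiIdx n r → ℂ} (ha : a ≠ 0) {O : Set (Euc n)}
    (hO : IsOpen O) (hne : O.Nonempty) : ∃ v ∈ O, polyVal a v ≠ 0 := by
  by_contra! hcon
  obtain ⟨z, hz⟩ := hne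
  have hO' : IsOpen ((WithLp.toLp 2 : (Fin n → ℝ) → Euc n) ⁻¹' O) :=
    hO.preimage (PiLp.continuous_toLp 2 _)
  obtain ⟨δ, hδ, hball⟩ := Metric.isOpen_iff.mp hO' (WithLp.ofLp z) hz
  let P : MvPolynomial (Fin n) ℂ :=
    ∑ α : multiIdx n r, MvPolynomial.monomial (Finsupp.equivFunOnFinite.symm α.1) (a α)
  have hP : P = 0 := by
    refine MvPolynomial.funext_set (fun j => (fun t : ℝ => (t : ℂ)) '' Metric.ball (z j) δ)
      (fun j => ?_) fun x hx => ?_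
    · refine Set.Infinite.image Complex.ofReal_injective.injOn ?_
      rw [Real.ball_eq_Ioo]
      exact Set.Ioo_infinite (by linarith)
    · choose t ht htx using fun j => hx j (Set.mem_univ j)
      have hmem : WithLp.toLp 2 t ∈ O := by
        refine hball ?_
        rw [ball_pi _ hδ]
        exact fun j _ => ht j
      have h0 := hcon _ hmem
      have hx' : x = fun j => (t j : ℂ) := funext fun j => (htx j).symm
      rw [map_zero, hx', ← h0]
      simp only [P, map_sum, MvPolynomial.eval_monomial, polyVal]
      refine Finset.sum_congr rfl fun α _ => ?_
      rw [Finsupp.prod_fintype _ _ (by simp)]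
      rfl
  refine ha (funext fun β => ?_)
  have hc : MvPolynomial.coeff (Finsupp.equivFunOnFinite.symm β.1) P = a β := by
    simp only [P, MvPolynomial.coeff_sum, MvPolynomial.coeff_monomial]
    rw [Finset.sum_eq_single β]
    · simp
    · intro α _ hαβ
      rw [if_neg]
      intro h
      exact hαβ (Subtype.ext (Finsupp.equivFunOnFinite.symm.injective h))
    · simp
  rw [← hc, hP]
  rfl

/-- Uniformly over the normalized polynomials of degree at most `r` and over the balls of radius
`ρ` with centre on the unit sphere, the ball contains a smaller ball of fixed radius on which the
polynomial is bounded away from zero. -/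
theorem exists_ball_le_norm_polyVal (n r : ℕ) {ρ : ℝ} (hρ : 0 < ρ) :
    ∃ ε > 0, ∃ η > 0, ∀ a : multiIdx n r → ℂ, ‖a‖ = 1 → ∀ ξ : Euc n, ‖ξ‖ = 1 →
      ∃ v₀, Metric.ball v₀ ε ⊆ Metric.ball ξ ρ ∧ ∀ v ∈ Metric.ball v₀ ε, η ≤ ‖polyVal a v‖ := by
  have hcomp : IsCompact (Metric.sphere (0 : multiIdx n r → ℂ) 1 ×ˢ Metric.sphere (0 : Euc n) 1) :=
    (isCompact_sphere _ _).prod (isCompact_sphere _ _)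
  have main := hcomp.induction_on
    (p := fun s => ∃ ε > 0, ∃ η > 0, ∀ x ∈ s,
      ∃ v₀, Metric.ball v₀ ε ⊆ Metric.ball x.2 ρ ∧
        ∀ v ∈ Metric.ball v₀ ε, η ≤ ‖polyVal x.1 v‖) ?_ ?_ ?_ ?_
  · obtain ⟨ε, hε, η, hη, h⟩ := main
    exact ⟨ε, hε, η, hη, fun a ha ξ hξ => h (a, ξ) ⟨by simpa using ha, by simpa using hξ⟩⟩
  · exact ⟨1, one_pos, 1, one_pos, by simp⟩
  · rintro s t hst ⟨ε, hε, η, hη, h⟩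
    exact ⟨ε, hε, η, hη, fun x hx => h x (hst hx)⟩
  · rintro s t ⟨ε, hε, η, hη, h⟩ ⟨ε', hε', η', hη', h'⟩
    refine ⟨min ε ε', lt_min hε hε', min η η', lt_min hη hη', ?_⟩
    rintro x (hx | hx)
    · obtain ⟨v₀, h1, h2⟩ := h x hx
      have hb := Metric.ball_subset_ball (x := v₀) (min_le_left ε ε')
      exact ⟨v₀, hb.trans h1, fun v hv => (min_le_left _ _).trans (h2 v (hb hv))⟩
    · obtain ⟨v₀, h1, h2⟩ := h' x hx
      have hb := Metric.ball_subset_ball (x := v₀) (min_le_right ε ε')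
      exact ⟨v₀, hb.trans h1, fun v hv => (min_le_right _ _).trans (h2 v (hb hv))⟩
  · rintro ⟨a₀, ξ₀⟩ ⟨ha, -⟩
    have ha0 : a₀ ≠ 0 := by
      rintro rfl
      simp at ha
    obtain ⟨v₀, hv₀, hne⟩ := exists_polyVal_ne_zero ha0 Metric.isOpen_ball
      (Metric.nonempty_ball.mpr hρ : (Metric.ball ξ₀ ρ).Nonempty)
    have hη : 0 < ‖polyVal a₀ v₀‖ / 2 := by positivity
    have hev : ∀ᶠ x : (multiIdx n r → ℂ) × Euc n in nhds (a₀, v₀),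
        ‖polyVal a₀ v₀‖ / 2 < ‖polyVal x.1 x.2‖ :=
      (continuous_polyVal.norm.continuousAt (x := (a₀, v₀))).eventually_const_lt
        (half_lt_self (by positivity))
    obtain ⟨δ, hδ, hδ'⟩ := Metric.eventually_nhds_iff_ball.mp hev
    have hgap : 0 < ρ - dist v₀ ξ₀ := by
      rw [Metric.mem_ball] at hv₀
      linarith
    refine ⟨Metric.ball (a₀, ξ₀) (min δ ((ρ - dist v₀ ξ₀) / 2)),
      mem_nhdsWithin_of_mem_nhds (Metric.ball_mem_nhds _ (lt_min hδ (by linarith))),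
      min δ ((ρ - dist v₀ ξ₀) / 2), lt_min hδ (by linarith), _, hη, ?_⟩
    rintro ⟨a, ξ⟩ hx
    rw [Metric.mem_ball, Prod.dist_eq, max_lt_iff, lt_min_iff, lt_min_iff] at hx
    obtain ⟨⟨hx1, -⟩, -, hx2⟩ := hx
    refine ⟨v₀, fun v hv => ?_, fun v hv => ?_⟩
    · rw [Metric.mem_ball, lt_min_iff] at hv
      have h1 := dist_triangle4 v v₀ ξ₀ ξ
      rw [Metric.mem_ball]
      rw [dist_comm ξ ξ₀] at hx2
      linarith [hv.2]
    · rw [Metric.mem_ball, lt_min_iff] at hv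
      refine (hδ' (a, v) ?_).le
      rw [Metric.mem_ball, Prod.dist_eq]
      exact max_lt hx1 hv.1

/-! ### Taylor expansion -/

/-- The coefficients of the Taylor polynomial of `g` at `y` in the variable `v`, where the
argument of `g` is `y + s v`. The coefficient `1 / α!` appears as the number of words with the
multi-index `α`, divided by `|α|!`. -/
noncomputable def taylorCoeff {n : ℕ} (r : ℕ) (g : Euc n → ℂ) (y : Euc n) (s : ℝ)
    (α : multiIdx n r) : ℂ :=
  ((((∑ j, α.1 j).factorial : ℝ)⁻¹ * s ^ (∑ j, α.1 j) *
    (Finset.univ.filter fun i : Fin (∑ j, α.1 j) → Fin n => occ i = α.1).card : ℝ) : ℂ) *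
      multiDeriv α.1 g y

theorem polyVal_taylorCoeff {n r : ℕ} {U : Set (Euc n)} (hU : IsOpen U) {g : Euc n → ℂ}
    (hg : ContDiffOn ℝ r g U) {y : Euc n} (hy : y ∈ U) (s : ℝ) (v : Euc n) :
    polyVal (taylorCoeff r g y s) v = ∑ l ∈ Finset.range (r + 1),
      (l.factorial : ℝ)⁻¹ • iteratedFDeriv ℝ l g y fun _ => s • v := by
  have h1 : ∀ l ∈ Finset.range (r + 1),
      (l.factorial : ℝ)⁻¹ • iteratedFDeriv ℝ l g y (fun _ => s • v)
        = ∑ α ∈ multiIdx n r with ∑ j, α j = l,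
          ((((∑ j, α j).factorial : ℝ)⁻¹ * s ^ (∑ j, α j) *
            (Finset.univ.filter fun i : Fin (∑ j, α j) → Fin n => occ i = α).card : ℝ) : ℂ) *
              multiDeriv α g y * ∏ j, (v j : ℂ) ^ α j := by
    intro l hl
    rw [Finset.mem_range] at hl
    rw [iteratedFDeriv_apply_eq_sum hU (hg.of_le (by exact_mod_cast Nat.lt_succ_iff.mp hl)) hy]
    rw [← Finset.sum_fiberwise_of_maps_to (s := Finset.univ) (g := fun i : Fin l → Fin n => occ i)
      (t := (multiIdx n r).filter fun α => ∑ j, α j = l)]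
    · rw [Finset.smul_sum]
      refine Finset.sum_congr rfl fun α hα => ?_
      obtain ⟨-, rfl⟩ := Finset.mem_filter.mp hα
      rw [Finset.sum_congr rfl (g := fun _ => ((s ^ (∑ j, α j) : ℝ) : ℂ) *
        (∏ j, (v j : ℂ) ^ α j) * multiDeriv α g y)]
      · rw [Finset.sum_const, Complex.real_smul, nsmul_eq_mul]
        push_cast
        ring
      · intro i hi
        rw [Finset.mem_filter] at hi
        have h2 : ∏ k, (s • v) (i k) = s ^ (∑ j, α j) * ∏ j, v j ^ α j := by
          simp only [PiLp.smul_apply, smul_eq_mul, Finset.prod_mul_distrib, Finset.prod_const,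
            Finset.card_univ, Fintype.card_fin]
          rw [prod_comp_eq_prod_pow_occ, hi.2]
        rw [h2, hi.2]
        push_cast
        ring
    · intro i _
      rw [Finset.mem_filter, mem_multiIdx, sum_occ]
      exact ⟨Nat.lt_succ_iff.mp hl, rfl⟩
  rw [Finset.sum_congr rfl h1, Finset.sum_fiberwise_of_maps_to]
  · unfold polyVal taylorCoeff
    exact Finset.sum_coe_sort (multiIdx n r) fun α =>
      ((((∑ j, α j).factorial : ℝ)⁻¹ * s ^ (∑ j, α j) *
        (Finset.univ.filter fun i : Fin (∑ j, α j) → Fin n => occ i = α).card : ℝ) : ℂ) *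
          multiDeriv α g y * ∏ j, (v j : ℂ) ^ α j
  · intro α hα
    rw [mem_multiIdx] at hα
    rw [Finset.mem_range]
    omega

theorem norm_multiDeriv_mul_le {n r : ℕ} (g : Euc n → ℂ) (y : Euc n) {s : ℝ} (hs : 0 < s)
    {α : Fin n → ℕ} (hα : ∑ j, α j ≤ r) :
    ‖multiDeriv α g y‖ * s ^ (∑ j, α j)
      ≤ (∑ j, α j).factorial * ‖taylorCoeff r g y s‖ := by
  have h := norm_le_pi_norm (taylorCoeff r g y s) ⟨α, mem_multiIdx.mpr hα⟩
  set N := (Finset.univ.filter fun i : Fin (∑ j, α j) → Fin n => occ i = α).card with hN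
  have hN1 : (1 : ℝ) ≤ N := by
    obtain ⟨i, hi⟩ := exists_occ_eq (rfl : ∑ j, α j = _)
    exact_mod_cast Finset.card_pos.mpr ⟨i, by simpa using hi⟩
  have hf : (0 : ℝ) < (∑ j, α j).factorial := by exact_mod_cast Nat.factorial_pos _
  unfold taylorCoeff at h
  rw [norm_mul, Complex.norm_real, Real.norm_of_nonneg (by positivity), ← hN] at h
  calc ‖multiDeriv α g y‖ * s ^ (∑ j, α j)
      ≤ ‖multiDeriv α g y‖ * s ^ (∑ j, α j) * N := le_mul_of_one_le_right (by positivity) hN1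
    _ = (∑ j, α j).factorial * (((∑ j, α j).factorial : ℝ)⁻¹ * s ^ (∑ j, α j) * N *
          ‖multiDeriv α g y‖) := by
        field_simp
    _ ≤ _ := by gcongr; exact h

theorem norm_sub_polyVal_taylorCoeff_le {n r : ℕ} {U : Set (Euc n)} (hU : IsOpen U)
    {g : Euc n → ℂ} (hg : ContDiffOn ℝ (r + 1 : ℕ) g U) {y : Euc n} {s D : ℝ} {v : Euc n}
    (hseg : ∀ t ∈ Set.Icc (0 : ℝ) 1, y + t • s • v ∈ U)
    (hD : ∀ z ∈ U, ‖iteratedFDeriv ℝ (r + 1) g z‖ ≤ D) :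
    ‖g (y + s • v) - polyVal (taylorCoeff r g y s) v‖ ≤ D * ‖s • v‖ ^ (r + 1) := by
  have hy : y ∈ U := by simpa using hseg 0 (by simp)
  have hD0 : 0 ≤ D := (norm_nonneg _).trans (hD y hy)
  rw [polyVal_taylorCoeff hU (hg.of_le (by exact_mod_cast Nat.le_succ r)) hy]
  rw [map_add_eq_sum_add_integral_iteratedFDeriv (f := g) (x := y) (y := s • v) (n := r)
    fun t ht => by exact_mod_cast hg.contDiffAt (hU.mem_nhds (hseg t ht)), add_sub_cancel_left,
    norm_smul]
  have hint : ‖∫ t in (0 : ℝ)..1, (1 - t) ^ r •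
      iteratedFDeriv ℝ (r + 1) g (y + t • s • v) fun _ => s • v‖
        ≤ D * ‖s • v‖ ^ (r + 1) * |1 - 0| := by
    refine intervalIntegral.norm_integral_le_of_norm_le_const fun t ht => ?_
    rw [Set.uIoc_of_le zero_le_one] at ht
    rw [norm_smul]
    have h1 : ‖(1 - t) ^ r‖ ≤ 1 := by
      rw [norm_pow, Real.norm_eq_abs]
      exact pow_le_one₀ (abs_nonneg _) (abs_le.mpr ⟨by linarith [ht.2], by linarith [ht.1]⟩)
    have h2 := (iteratedFDeriv ℝ (r + 1) g (y + t • s • v)).le_of_opNorm_le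
      (hD _ (hseg t ⟨ht.1.le, ht.2⟩)) fun _ => s • v
    rw [Finset.prod_const, Finset.card_univ, Fintype.card_fin] at h2
    calc _ ≤ 1 * (D * ‖s • v‖ ^ (r + 1)) := by gcongr
      _ = _ := one_mul _
  have h3 : ‖((r.factorial : ℝ))⁻¹‖ ≤ 1 := by
    rw [norm_inv, Real.norm_natCast]
    exact inv_le_one_of_one_le₀ (by exact_mod_cast Nat.factorial_pos r)
  calc _ ≤ 1 * (D * ‖s • v‖ ^ (r + 1) * |1 - 0|) := by gcongr
    _ = _ := by simp

/-! ### Functions with many zeros in a domain with the cone property -/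

theorem InteriorCone.exists_ball {n : ℕ} {U : Set (Euc n)} (hU : InteriorCone U) :
    ∃ ρ r : ℝ, 0 < ρ ∧ ρ < 1 ∧ 0 < r ∧ ∀ x ∈ U, ∃ ξ : Euc n, ‖ξ‖ = 1 ∧
      ∀ v ∈ Metric.ball ξ ρ, ∀ t ∈ Set.Icc 0 r, x + t • v ∈ U := by
  obtain ⟨θ, r, hθ, hθ', hr, h⟩ := hU
  have hc : 0 < Real.cos θ := Real.cos_pos_of_mem_Ioo ⟨by linarith, hθ'⟩
  have hc1 : Real.cos θ < 1 := by
    have := Real.cos_lt_cos_of_nonneg_of_le_pi_div_two le_rfl hθ'.le hθ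
    simpa using this
  set ρ := (1 - Real.cos θ) / (1 + Real.cos θ) with hρdef
  have hρ : 0 < ρ := by
    have : 0 < 1 - Real.cos θ := by linarith
    positivity
  have hρ1 : ρ < 1 := by
    rw [hρdef, div_lt_one (by linarith)]
    linarith
  have hρc : Real.cos θ * (1 + ρ) = 1 - ρ := by
    rw [hρdef]
    field_simp
    ring
  refine ⟨ρ, r / 2, hρ, hρ1, by linarith, fun x hx => ?_⟩
  obtain ⟨ξ, hξ, hcone⟩ := h x hx
  refine ⟨ξ, hξ, fun v hv t ht => ?_⟩
  rw [Metric.mem_ball, dist_eq_norm] at hv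
  have hv1 : ‖v‖ ≤ 1 + ρ := by
    calc ‖v‖ = ‖ξ + (v - ξ)‖ := by congr 1; abel
      _ ≤ ‖ξ‖ + ‖v - ξ‖ := norm_add_le _ _
      _ ≤ 1 + ρ := by rw [hξ]; linarith
  have hin : 1 - ρ ≤ inner ℝ v ξ := by
    have h1 : inner ℝ v ξ = inner ℝ (v - ξ) ξ + 1 := by
      rw [inner_sub_left, real_inner_self_eq_norm_sq, hξ]
      ring
    have h2 := abs_real_inner_le_norm (v - ξ) ξ
    rw [hξ, mul_one] at h2
    have h3 := (abs_le.mp h2).1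
    linarith
  have hv0 : 0 < ‖v‖ := by
    rw [norm_pos_iff]
    rintro rfl
    rw [inner_zero_left] at hin
    linarith
  have := hcone (‖v‖⁻¹ • v) (by rw [norm_smul, norm_inv, norm_norm, inv_mul_cancel₀ hv0.ne']) ?_
    (t * ‖v‖) ⟨mul_nonneg ht.1 hv0.le, ?_⟩
  · rwa [smul_smul, mul_assoc, mul_inv_cancel₀ hv0.ne', mul_one] at this
  · rw [real_inner_smul_left, ← div_eq_inv_mul, le_div_iff₀ hv0]
    calc Real.cos θ * ‖v‖ ≤ Real.cos θ * (1 + ρ) := by gcongr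
      _ ≤ _ := by rw [hρc]; exact hin
  · have := ht.2
    nlinarith [ht.1]

/-- A sampling inequality: on a domain with the interior cone property, a `C^q` function with a
zero in every ball of radius proportional to `h` inside the domain has partial derivatives of
order `l` of size `O(h^(q-l))`. In a cone of height proportional to `h`, the Taylor polynomial is
small at the zeros of the function, and these zeros are a norming set for polynomials. -/
theorem norm_multiDeriv_le_of_zeros {n q : ℕ} (hq : 1 ≤ q) {U : Set (Euc n)} (hU : IsOpen U)
    (hcone : InteriorCone U) {C₁ : ℝ} (hC₁ : 0 < C₁) :
    ∃ h₁ > 0, ∃ C > 0, ∀ h, 0 < h → h ≤ h₁ → ∀ g : Euc n → ℂ, ContDiffOn ℝ q g U →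
      ∀ D : ℝ, (∀ l ≤ q, ∀ y ∈ U, ‖iteratedFDeriv ℝ l g y‖ ≤ D) →
      (∀ y, Metric.ball y (C₁ * h) ⊆ U → ∃ z ∈ Metric.ball y (C₁ * h), g z = 0) →
      ∀ α : Fin n → ℕ, ∑ j, α j ≤ q → ∀ y ∈ U,
        ‖multiDeriv α g y‖ ≤ C * D * h ^ (q - ∑ j, α j) := by
  obtain ⟨r, rfl⟩ : ∃ r, q = r + 1 := ⟨q - 1, by omega⟩
  obtain ⟨ρ, r₀, hρ, hρ1, hr₀, hball⟩ := hcone.exists_ball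
  obtain ⟨ε, hε, η, hη, hnorm⟩ := exists_ball_le_norm_polyVal n r hρ
  set κ := C₁ / ε with hκdef
  have hκ : 0 < κ := by positivity
  refine ⟨r₀ / κ, by positivity, r.factorial * η⁻¹ * 2 ^ (r + 1) * (1 + κ) ^ (r + 1) + 1,
    by positivity, ?_⟩
  intro h hh hh₁ g hg D hD hzero α hα y hy
  have hD0 : 0 ≤ D := (norm_nonneg _).trans (hD 0 (by omega) y hy)
  rcases hα.lt_or_eq with hlt | heq
  swap
  · have h1 := norm_multiDeriv_le hU hg hy heq
    rw [heq, Nat.sub_self, pow_zero, mul_one]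
    refine (h1.trans (hD _ le_rfl y hy)).trans (le_mul_of_one_le_left hD0 ?_)
    rw [le_add_iff_nonneg_left]
    positivity
  set l := ∑ j, α j with hl
  set s := κ * h with hsdef
  have hs : 0 < s := by positivity
  have hsr : s ≤ r₀ := by
    rw [le_div_iff₀ hκ] at hh₁
    linarith
  have hsε : C₁ * h = s * ε := by
    rw [hsdef, hκdef]
    field_simp
  obtain ⟨ξ, hξ, hin⟩ := hball y hy
  -- the Taylor polynomial is small at the zeros of `g`, hence has small coefficients
  have hcoef : η * ‖taylorCoeff r g y s‖ ≤ D * (2 * s) ^ (r + 1) := by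
    set a := taylorCoeff r g y s with ha
    rcases eq_or_ne a 0 with h0 | h0
    · rw [h0, norm_zero, mul_zero]
      positivity
    have ha0 : 0 < ‖a‖ := norm_pos_iff.mpr h0
    obtain ⟨v₀, hv₀, hlow⟩ := hnorm (((‖a‖⁻¹ : ℝ) : ℂ) • a)
      (by rw [norm_smul, Complex.norm_real, norm_inv, norm_norm, inv_mul_cancel₀ ha0.ne']) ξ hξ
    have hscale : ∀ z ∈ Metric.ball (y + s • v₀) (C₁ * h),
        ∃ v ∈ Metric.ball v₀ ε, z = y + s • v := by
      intro z hz
      refine ⟨s⁻¹ • (z - y), ?_, ?_⟩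
      · have h1 : s⁻¹ • (z - y) - v₀ = s⁻¹ • (z - (y + s • v₀)) := by
          rw [← sub_sub, smul_sub _ (z - y), smul_smul, inv_mul_cancel₀ hs.ne', one_smul]
        rw [Metric.mem_ball, dist_eq_norm] at hz ⊢
        rw [h1, norm_smul, norm_inv, Real.norm_of_nonneg hs.le, inv_mul_lt_iff₀ hs, ← hsε]
        exact hz
      · rw [smul_smul, mul_inv_cancel₀ hs.ne', one_smul]
        abel
    obtain ⟨z, hz, hgz⟩ := hzero (y + s • v₀) fun z hz => by
      obtain ⟨v, hv, rfl⟩ := hscale z hz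
      exact hin v (hv₀ hv) s ⟨hs.le, hsr⟩
    obtain ⟨v, hv, rfl⟩ := hscale z hz
    have hv2 : ‖v‖ ≤ 2 := by
      have h1 := hv₀ hv
      rw [Metric.mem_ball, dist_eq_norm] at h1
      calc ‖v‖ = ‖ξ + (v - ξ)‖ := by congr 1; abel
        _ ≤ ‖ξ‖ + ‖v - ξ‖ := norm_add_le _ _
        _ ≤ 2 := by rw [hξ]; linarith
    have hup := norm_sub_polyVal_taylorCoeff_le (r := r) hU hg (y := y) (s := s) (v := v)
      (fun t ht => by
        rw [smul_smul]
        exact hin v (hv₀ hv) (t * s) ⟨mul_nonneg ht.1 hs.le, by nlinarith [ht.1, ht.2]⟩)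
      (hD _ le_rfl)
    rw [hgz, zero_sub, norm_neg, ← ha] at hup
    have hlow' := hlow v hv
    rw [polyVal_smul, norm_mul, Complex.norm_real, norm_inv, norm_norm,
      le_inv_mul_iff₀ ha0] at hlow'
    calc η * ‖a‖ = ‖a‖ * η := mul_comm _ _
      _ ≤ ‖polyVal a v‖ := hlow'
      _ ≤ D * ‖s • v‖ ^ (r + 1) := hup
      _ ≤ D * (2 * s) ^ (r + 1) := by
          rw [norm_smul, Real.norm_of_nonneg hs.le, mul_comm s]
          gcongr
  have hder := norm_multiDeriv_mul_le (r := r) g y hs (α := α) (by omega)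
  rw [← hl] at hder
  have hsplit : s ^ (r + 1) = s ^ l * s ^ (r + 1 - l) := by
    rw [← pow_add]
    congr 1
    omega
  have hfac : (l.factorial : ℝ) ≤ r.factorial := by
    exact_mod_cast Nat.factorial_le (by omega)
  have hmain : ‖multiDeriv α g y‖ * s ^ l ≤
      (r.factorial * η⁻¹ * 2 ^ (r + 1) * D * s ^ (r + 1 - l)) * s ^ l := by
    calc _ ≤ l.factorial * ‖taylorCoeff r g y s‖ := hder
      _ ≤ r.factorial * (η⁻¹ * (D * (2 * s) ^ (r + 1))) := by
          gcongr
          rwa [le_inv_mul_iff₀ hη]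
      _ = _ := by
          rw [mul_pow, hsplit]
          ring
  have hfin := le_of_mul_le_mul_right hmain (by positivity)
  have hκpow : κ ^ (r + 1 - l) ≤ (1 + κ) ^ (r + 1) :=
    (pow_le_pow_left₀ hκ.le (by linarith) _).trans
      (pow_le_pow_right₀ (by linarith) (Nat.sub_le _ _))
  calc ‖multiDeriv α g y‖ ≤ r.factorial * η⁻¹ * 2 ^ (r + 1) * D * s ^ (r + 1 - l) := hfin
    _ = r.factorial * η⁻¹ * 2 ^ (r + 1) * κ ^ (r + 1 - l) * D * h ^ (r + 1 - l) := by
        rw [hsdef, mul_pow]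
        ring
    _ ≤ r.factorial * η⁻¹ * 2 ^ (r + 1) * (1 + κ) ^ (r + 1) * D * h ^ (r + 1 - l) := by
        gcongr
    _ ≤ _ := by
        gcongr
        linarith

/-! ### Quantitative surjectivity -/

/-- If at every point of the ball `B(y₀, R)` the equation `DG(y) v = w - G(y)` has a solution of
norm at most `c ‖w - G(y)‖`, and `c ‖w - G(y₀)‖ < R`, then `G` takes the value `w` on the ball: a
minimizer of `c' ‖w - G(y)‖ + ‖y - y₀‖`, with `c'` slightly larger than `c`, is such a point. -/
theorem exists_mem_ball_eq_of_fderiv {E F : Type*} [NormedAddCommGroup E] [NormedSpace ℝ E]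
    [ProperSpace E] [NormedAddCommGroup F] [NormedSpace ℝ F] {G : E → F} {y₀ : E} {R c : ℝ} {w : F} (hc : 0 ≤ c)
    (hG : ∀ y ∈ Metric.ball y₀ R, DifferentiableAt ℝ G y)
    (hv : ∀ y ∈ Metric.ball y₀ R, ∃ v, fderiv ℝ G y v = w - G y ∧ ‖v‖ ≤ c * ‖w - G y‖)
    (hR : c * ‖w - G y₀‖ < R) : ∃ y ∈ Metric.ball y₀ R, G y = w := by
  set D₀ := ‖w - G y₀‖ with hD₀
  have hD₀' : 0 ≤ D₀ := norm_nonneg _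
  obtain ⟨c', hcc', hc'⟩ : ∃ c', c < c' ∧ c' * D₀ < R := by
    refine ⟨c + (R - c * D₀) / (2 * (D₀ + 1)), ?_, ?_⟩
    · have : 0 < (R - c * D₀) / (2 * (D₀ + 1)) := div_pos (by linarith) (by linarith)
      linarith
    · have h1 : (R - c * D₀) / (2 * (D₀ + 1)) * D₀ ≤ (R - c * D₀) / 2 := by
        rw [div_mul_eq_mul_div, div_le_div_iff₀ (by linarith) (by norm_num)]
        nlinarith
      rw [add_mul]
      linarith
  obtain ⟨R', hR'1, hR'2⟩ := exists_between hc'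
  have hc'0 : 0 < c' := by linarith
  have hR'0 : 0 ≤ R' := by nlinarith
  have hsub : Metric.closedBall y₀ R' ⊆ Metric.ball y₀ R := Metric.closedBall_subset_ball hR'2
  have hcont : ContinuousOn (fun y => c' * ‖w - G y‖ + ‖y - y₀‖) (Metric.closedBall y₀ R') := by
    have hGc : ContinuousOn G (Metric.closedBall y₀ R') := fun y hy =>
      (hG y (hsub hy)).continuousAt.continuousWithinAt
    fun_prop
  obtain ⟨y, hy, hmin⟩ := (isCompact_closedBall y₀ R').exists_isMinOn
    ⟨y₀, Metric.mem_closedBall_self hR'0⟩ hcont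
  refine ⟨y, hsub hy, ?_⟩
  by_contra hne
  have hD : 0 < ‖w - G y‖ := norm_pos_iff.mpr (sub_ne_zero.mpr (Ne.symm hne))
  have hy0 := hmin (Metric.mem_closedBall_self hR'0)
  simp only [Set.mem_ofPred_eq, sub_self, norm_zero, add_zero] at hy0
  have hyR : y ∈ Metric.ball y₀ R' := by
    rw [Metric.mem_ball, dist_eq_norm]
    nlinarith [norm_nonneg (w - G y)]
  obtain ⟨v, hv1, hv2⟩ := hv y (hsub hy)
  have hder : HasDerivAt (fun t : ℝ => G (y + t • v)) (w - G y) 0 := by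
    have h1 : HasDerivAt (fun t : ℝ => y + t • v) v 0 := by
      simpa using ((hasDerivAt_id (0 : ℝ)).smul_const v).const_add y
    have h2 : HasFDerivAt G (fderiv ℝ G y) (y + (0 : ℝ) • v) := by
      simpa using (hG y (hsub hy)).hasFDerivAt
    have h3 := h2.comp_hasDerivAt (0 : ℝ) h1
    rwa [hv1] at h3
  set b := (c' - c) * ‖w - G y‖ / (2 * c') with hb
  have hb0 : 0 < b := div_pos (mul_pos (by linarith) hD) (by linarith)
  have hbc : c' * b = (c' - c) * ‖w - G y‖ / 2 := by
    rw [hb]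
    field_simp
  have he1 := (hasDerivAt_iff_isLittleO.mp hder).def hb0
  have he2 : ∀ᶠ t : ℝ in nhds 0, y + t • v ∈ Metric.ball y₀ R' := by
    have h1 : Continuous fun t : ℝ => y + t • v := by fun_prop
    exact h1.continuousAt.eventually_mem (Metric.isOpen_ball.mem_nhds (by simpa using hyR))
  have he3 : ∀ᶠ t : ℝ in nhds 0, t < 1 := eventually_lt_nhds one_pos
  obtain ⟨t, ⟨⟨ht1, ht2⟩, ht3⟩, ht0⟩ := (((he1.and he2).and he3).filter_mono
    (nhdsWithin_le_nhds (s := Set.Ioi 0))).and self_mem_nhdsWithin |>.exists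
  replace ht0 : 0 < t := ht0
  simp only [zero_smul, add_zero, sub_zero, Real.norm_eq_abs, abs_of_pos ht0] at ht1
  have hup : ‖w - G (y + t • v)‖ ≤ (1 - t) * ‖w - G y‖ + b * t := by
    calc ‖w - G (y + t • v)‖
        = ‖(1 - t) • (w - G y) - (G (y + t • v) - G y - t • (w - G y))‖ := by
          congr 1
          rw [sub_smul, one_smul]
          abel
      _ ≤ ‖(1 - t) • (w - G y)‖ + ‖G (y + t • v) - G y - t • (w - G y)‖ := norm_sub_le _ _
      _ ≤ _ := by
          rw [norm_smul, Real.norm_of_nonneg (by linarith)]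
          gcongr
  have hlen : ‖y + t • v - y₀‖ ≤ ‖y - y₀‖ + t * (c * ‖w - G y‖) := by
    calc ‖y + t • v - y₀‖ = ‖(y - y₀) + t • v‖ := by congr 1; abel
      _ ≤ ‖y - y₀‖ + ‖t • v‖ := norm_add_le _ _
      _ ≤ _ := by
          rw [norm_smul, Real.norm_of_nonneg ht0.le]
          gcongr
  have hmin' := hmin (Metric.ball_subset_closedBall ht2)
  simp only [Set.mem_ofPred_eq] at hmin'
  have h1 := mul_le_mul_of_nonneg_left hup hc'0.le
  have h2 : c' * ((1 - t) * ‖w - G y‖ + b * t)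
      = c' * ‖w - G y‖ - t * (c' * ‖w - G y‖) + t * (c' * b) := by ring
  have h3 : 0 < t * ((c' - c) * ‖w - G y‖) := mul_pos ht0 (mul_pos (by linarith) hD)
  rw [h2, hbc] at h1
  nlinarith

/-! ### Flattening a submanifold -/

/-- The coordinate slice `ℝᵏ × {0}` of `ℝᵐ`. -/
def slice (k m : ℕ) : Submodule ℝ (Euc m) where
  carrier := {v | ∀ i : Fin m, k ≤ (i : ℕ) → v i = 0}
  add_mem' := fun ha hb i hi => by simp [ha i hi, hb i hi]
  zero_mem' := fun i _ => rfl
  smul_mem' := fun t a ha i hi => by simp [ha i hi]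

theorem finrank_slice_le (k m : ℕ) : Module.finrank ℝ (slice k m) ≤ k := by
  let T : slice k m →ₗ[ℝ] (Fin k → ℝ) := LinearMap.pi fun i =>
    if h : (i : ℕ) < m then
      (EuclideanSpace.proj (⟨i, h⟩ : Fin m) : Euc m →L[ℝ] ℝ).toLinearMap ∘ₗ (slice k m).subtype
    else 0
  have hT : Function.Injective T := by
    rw [injective_iff_map_eq_zero]
    intro v hv
    ext i
    by_cases hi : (i : ℕ) < k
    · have h := congrFun hv ⟨i, hi⟩
      simpa [T] using h
    · exact v.2 i (not_lt.mp hi)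
  simpa using LinearMap.finrank_le_finrank_of_injective hT

theorem exists_eq_of_mem_slice {k m : ℕ} {T : Euc k →ₗ[ℝ] Euc m} (hT : Function.Injective T)
    (hTW : ∀ v, T v ∈ slice k m) {w : Euc m} (hw : w ∈ slice k m) : ∃ v, T v = w := by
  have hle : T.range ≤ slice k m := by
    rintro _ ⟨v, rfl⟩
    exact hTW v
  have heq : T.range = slice k m := by
    refine Submodule.eq_of_le_of_finrank_le hle ((finrank_slice_le k m).trans ?_)
    rw [LinearMap.finrank_range_of_inj hT]
    simp
  rw [← heq] at hw
  exact hw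

theorem fderiv_mem_slice {n k m : ℕ} {G : Euc n → Euc m} {y : Euc n}
    (hG : DifferentiableAt ℝ G y) (hmem : ∀ᶠ z in nhds y, G z ∈ slice k m) (v : Euc n) :
    fderiv ℝ G y v ∈ slice k m := by
  intro i hi
  have h1 : HasFDerivAt (fun z => G z i)
      ((EuclideanSpace.proj i : Euc m →L[ℝ] ℝ).comp (fderiv ℝ G y)) y :=
    (EuclideanSpace.proj i : Euc m →L[ℝ] ℝ).hasFDerivAt.comp y hG.hasFDerivAt
  have h2 : (fun z => G z i) =ᶠ[nhds y] fun _ => (0 : ℝ) := by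
    filter_upwards [hmem] with z hz using hz i hi
  have h3 := h1.unique ((hasFDerivAt_const (0 : ℝ) y).congr_of_eventuallyEq h2)
  exact congrArg (fun T : Euc n →L[ℝ] ℝ => T v) h3

/-- Near a compact part of a submanifold, the flattening diffeomorphisms can be chosen on balls of
a fixed radius and with uniform bounds. -/
theorem IsSubmanifold.exists_uniform {m k : ℕ} {M : Set (Euc m)} (hM : IsSubmanifold k M)
    {A : Set (Euc m)} (hA : IsCompact A) (hAM : A ⊆ M) :
    ∃ δ > 0, ∃ L > 0, ∀ x ∈ A, ∃ Φ : OpenPartialHomeomorph (Euc m) (Euc m),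
      (∀ z ∈ Metric.ball x δ, z ∈ Φ.source ∧ DifferentiableAt ℝ Φ z ∧
        DifferentiableAt ℝ Φ.symm (Φ z) ∧ ‖fderiv ℝ Φ.symm (Φ z)‖ ≤ L ∧
        ‖Φ z - Φ x‖ ≤ L * ‖z - x‖) ∧
      ∀ z ∈ Φ.source, z ∈ M ↔ Φ z ∈ slice k m := by
  refine hA.induction_on
    (p := fun s => ∃ δ > 0, ∃ L > 0, ∀ x ∈ s, ∃ Φ : OpenPartialHomeomorph (Euc m) (Euc m),
      (∀ z ∈ Metric.ball x δ, z ∈ Φ.source ∧ DifferentiableAt ℝ Φ z ∧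
        DifferentiableAt ℝ Φ.symm (Φ z) ∧ ‖fderiv ℝ Φ.symm (Φ z)‖ ≤ L ∧
        ‖Φ z - Φ x‖ ≤ L * ‖z - x‖) ∧
      ∀ z ∈ Φ.source, z ∈ M ↔ Φ z ∈ slice k m) ?_ ?_ ?_ ?_
  · exact ⟨1, one_pos, 1, one_pos, by simp⟩
  · rintro s t hst ⟨δ, hδ, L, hL, h⟩
    exact ⟨δ, hδ, L, hL, fun x hx => h x (hst hx)⟩
  · have hmono : ∀ δ δ' L L' : ℝ, δ' ≤ δ → L ≤ L' → ∀ x,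
        (∃ Φ : OpenPartialHomeomorph (Euc m) (Euc m),
          (∀ z ∈ Metric.ball x δ, z ∈ Φ.source ∧ DifferentiableAt ℝ Φ z ∧
            DifferentiableAt ℝ Φ.symm (Φ z) ∧ ‖fderiv ℝ Φ.symm (Φ z)‖ ≤ L ∧
            ‖Φ z - Φ x‖ ≤ L * ‖z - x‖) ∧
          ∀ z ∈ Φ.source, z ∈ M ↔ Φ z ∈ slice k m) →
        ∃ Φ : OpenPartialHomeomorph (Euc m) (Euc m),
          (∀ z ∈ Metric.ball x δ', z ∈ Φ.source ∧ DifferentiableAt ℝ Φ z ∧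
            DifferentiableAt ℝ Φ.symm (Φ z) ∧ ‖fderiv ℝ Φ.symm (Φ z)‖ ≤ L' ∧
            ‖Φ z - Φ x‖ ≤ L' * ‖z - x‖) ∧
          ∀ z ∈ Φ.source, z ∈ M ↔ Φ z ∈ slice k m := by
      rintro δ δ' L L' hδ hL x ⟨Φ, h1, h2⟩
      refine ⟨Φ, fun z hz => ?_, h2⟩
      obtain ⟨a, b, c, d, e⟩ := h1 z (Metric.ball_subset_ball hδ hz)
      exact ⟨a, b, c, d.trans hL, e.trans (by gcongr)⟩
    rintro s t ⟨δ, hδ, L, hL, h⟩ ⟨δ', hδ', L', hL', h'⟩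
    refine ⟨min δ δ', lt_min hδ hδ', max L L', lt_max_of_lt_left hL, ?_⟩
    rintro x (hx | hx)
    · exact hmono _ _ _ _ (min_le_left _ _) (le_max_left _ _) x (h x hx)
    · exact hmono _ _ _ _ (min_le_right _ _) (le_max_right _ _) x (h' x hx)
  · intro x₀ hx₀
    obtain ⟨Φ, hx, hΦ, hΦs, hsl⟩ := hM x₀ (hAM hx₀)
    have hc1 : ContinuousAt (fderiv ℝ Φ) x₀ :=
      (hΦ.continuousOn_fderiv_of_isOpen Φ.open_source le_rfl).continuousAt
        (Φ.open_source.mem_nhds hx)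
    have hc2 : ContinuousAt (fun z => fderiv ℝ Φ.symm (Φ z)) x₀ :=
      ContinuousAt.comp (g := fderiv ℝ Φ.symm)
        ((hΦs.continuousOn_fderiv_of_isOpen Φ.open_target le_rfl).continuousAt
          (Φ.open_target.mem_nhds (Φ.map_source hx))) (Φ.continuousAt hx)
    set L := max (‖fderiv ℝ Φ x₀‖ + 1) (‖fderiv ℝ Φ.symm (Φ x₀)‖ + 1) with hL
    have he1 : ∀ᶠ z in nhds x₀, ‖fderiv ℝ Φ z‖ < L :=
      hc1.norm.eventually_lt_const (by rw [hL]; exact lt_max_of_lt_left (lt_add_one _))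
    have he2 : ∀ᶠ z in nhds x₀, ‖fderiv ℝ Φ.symm (Φ z)‖ < L :=
      hc2.norm.eventually_lt_const (by rw [hL]; exact lt_max_of_lt_right (lt_add_one _))
    obtain ⟨δ, hδ, hball⟩ := Metric.eventually_nhds_iff_ball.mp
      ((he1.and he2).and (Φ.open_source.mem_nhds hx))
    have hdiff : ∀ z ∈ Φ.source, DifferentiableAt ℝ Φ z := fun z hz =>
      (hΦ.contDiffAt (Φ.open_source.mem_nhds hz)).differentiableAt one_ne_zero
    refine ⟨Metric.ball x₀ (δ / 2),
      mem_nhdsWithin_of_mem_nhds (Metric.ball_mem_nhds _ (by linarith)), δ / 2, by linarith, L,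
      lt_max_of_lt_left (by positivity), fun x hxx => ⟨Φ, fun z hz => ?_, hsl⟩⟩
    have hzb : z ∈ Metric.ball x₀ δ := by
      rw [Metric.mem_ball] at *
      linarith [dist_triangle z x x₀]
    have hxb : x ∈ Metric.ball x₀ δ := Metric.ball_subset_ball (by linarith) hxx
    obtain ⟨⟨hz1, hz2⟩, hz3⟩ := hball z hzb
    refine ⟨hz3, hdiff z hz3, ?_, hz2.le, ?_⟩
    · exact (hΦs.contDiffAt (Φ.open_target.mem_nhds (Φ.map_source hz3))).differentiableAt
        one_ne_zero
    · exact (convex_ball x₀ δ).norm_image_sub_le_of_norm_fderiv_le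
        (fun u hu => hdiff u (hball u hu).2) (fun u hu => (hball u hu).1.1.le) hxb hzb

/-! ### Images of balls under the charts -/

/-- The derivative of a chart is uniformly bounded above and below; the lower bound comes from the
bound on the inverse metric tensor. -/
theorem IsChart.exists_bounds {k m q : ℕ} (hq : 1 ≤ q) {S : Set (Euc m)} {U : Set (Euc k)}
    {σ : Euc k → Euc m} (hσ : IsChart q S U σ) :
    ∃ A > 0, ∀ y ∈ U, ‖fderiv ℝ σ y‖ ≤ A ∧ ∀ v, ‖v‖ ≤ A * ‖fderiv ℝ σ y v‖ := by
  obtain ⟨A₁, hA₁⟩ := hσ.bounded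
  obtain ⟨A₂, hA₂⟩ := hσ.metric
  set B₁ := max A₁ 1 with hB₁
  set B₂ := max A₂ 1 with hB₂
  have hB₁0 : 0 < B₁ := lt_max_of_lt_right one_pos
  have hB₂0 : 0 < B₂ := lt_max_of_lt_right one_pos
  refine ⟨B₁ + k * (k * (B₂ * B₁)), by positivity, fun y hy => ?_⟩
  have hd : ‖fderiv ℝ σ y‖ ≤ B₁ := by
    rw [← norm_iteratedFDeriv_one]
    exact (hA₁ 1 hq y hy).trans (le_max_left _ _)
  refine ⟨hd.trans (by rw [le_add_iff_nonneg_right]; positivity), fun v => ?_⟩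
  obtain ⟨hdet, hinv⟩ := hA₂ y hy
  set g := metricTensor σ y with hg
  set T := fderiv ℝ σ y with hT
  have hvsum : v = ∑ b, v b • EuclideanSpace.single b (1 : ℝ) := by
    ext j
    simp [Finset.sum_apply, Pi.single_apply]
  have hgv : ∀ a, (g.mulVec fun b => v b) a
      = inner ℝ (T (EuclideanSpace.single a 1)) (T v) := by
    intro a
    have h1 : T v = ∑ b, v b • T (EuclideanSpace.single b 1) := by
      conv_lhs => rw [hvsum, map_sum]
      simp
    rw [h1, inner_sum, Matrix.mulVec, dotProduct]
    refine Finset.sum_congr rfl fun b _ => ?_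
    rw [real_inner_smul_right, mul_comm]
    rfl
  have hgv' : ∀ a, |(g.mulVec fun b => v b) a| ≤ B₁ * ‖T v‖ := by
    intro a
    rw [hgv]
    refine (abs_real_inner_le_norm _ _).trans ?_
    gcongr
    refine (T.le_of_opNorm_le hd _).trans ?_
    simp
  have hva : ∀ a, |v a| ≤ k * (B₂ * (B₁ * ‖T v‖)) := by
    intro a
    have h1 : (fun b => v b) = g⁻¹.mulVec (g.mulVec fun b => v b) := by
      rw [Matrix.mulVec_mulVec, Matrix.nonsing_inv_mul _ (isUnit_iff_ne_zero.mpr hdet),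
        Matrix.one_mulVec]
    have h2 := congrFun h1 a
    simp only at h2
    rw [h2]
    calc _ ≤ ∑ b : Fin k, |g⁻¹ a b * (g.mulVec fun b => v b) b| :=
          Finset.abs_sum_le_sum_abs _ _
      _ ≤ ∑ b : Fin k, B₂ * (B₁ * ‖T v‖) := by
          refine Finset.sum_le_sum fun b _ => ?_
          rw [abs_mul]
          exact mul_le_mul ((hinv a b).trans (le_max_left _ _)) (hgv' b) (abs_nonneg _) hB₂0.le
      _ = _ := by simp
  calc ‖v‖ = ‖∑ b, v b • EuclideanSpace.single b (1 : ℝ)‖ := by rw [← hvsum]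
    _ ≤ ∑ b : Fin k, k * (B₂ * (B₁ * ‖T v‖)) := by
        refine norm_sum_le_of_le _ fun b _ => ?_
        rw [norm_smul, Real.norm_eq_abs]
        simpa using hva b
    _ = k * (k * (B₂ * B₁)) * ‖T v‖ := by
        simp
        ring
    _ ≤ _ := by
        gcongr
        linarith

/-- A chart maps balls of radius proportional to `h` onto sets containing all points of the
submanifold at distance at most `h` from the image of the centre. -/
theorem IsChart.exists_mem_ball_eq {k m q : ℕ} (hq : 1 ≤ q) {S M : Set (Euc m)}
    (hS : IsCompact (closure S)) (hM : IsSubmanifold k M) (hSM : closure S ⊆ M)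
    {U : Set (Euc k)} {σ : Euc k → Euc m} (hσ : IsChart q S U σ) :
    ∃ h₁ > 0, ∃ C₁ > 0, ∀ h, 0 < h → h ≤ h₁ → ∀ y₀, Metric.ball y₀ (C₁ * h) ⊆ U →
      ∀ z ∈ M, dist (σ y₀) z ≤ h → ∃ y ∈ Metric.ball y₀ (C₁ * h), σ y = z := by
  obtain ⟨A, hA, hσA⟩ := hσ.exists_bounds hq
  obtain ⟨δ, hδ, L, hL, hflat⟩ := hM.exists_uniform hS hSM
  set C₁ := A * L * L + 1 with hC₁
  have hC₁0 : 0 < C₁ := by positivity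
  refine ⟨min (δ / 2) (δ / (A * C₁)), lt_min (by linarith) (by positivity), C₁, hC₁0, ?_⟩
  intro h hh hh₁ y₀ hball z hz hdist
  have hy₀ : y₀ ∈ U := hball (Metric.mem_ball_self (by positivity))
  obtain ⟨Φ, hΦ, hsl⟩ := hflat (σ y₀) (subset_closure (hσ.mapsTo hy₀))
  have hσd : ∀ y ∈ U, DifferentiableAt ℝ σ y := fun y hy =>
    (hσ.contDiffOn.contDiffAt (hσ.isOpen.mem_nhds hy)).differentiableAt
      (by exact_mod_cast Nat.one_le_iff_ne_zero.mp hq)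
  have hnear : ∀ y ∈ Metric.ball y₀ (C₁ * h), σ y ∈ Metric.ball (σ y₀) δ := by
    intro y hy
    have h1 := (convex_ball y₀ (C₁ * h)).norm_image_sub_le_of_norm_fderiv_le
      (fun u hu => hσd u (hball hu)) (fun u hu => (hσA u (hball hu)).1)
      (Metric.mem_ball_self (by positivity)) hy
    rw [Metric.mem_ball, dist_eq_norm] at hy ⊢
    have h2 : h * (A * C₁) ≤ δ := by
      rw [← le_div_iff₀ (by positivity)]
      exact hh₁.trans (min_le_right _ _)
    calc _ ≤ A * ‖y - y₀‖ := h1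
      _ < A * (C₁ * h) := by gcongr
      _ ≤ δ := by linarith
  have hzδ : z ∈ Metric.ball (σ y₀) δ := by
    rw [Metric.mem_ball, dist_comm]
    linarith [hh₁.trans (min_le_left _ _)]
  have hzs := (hΦ z hzδ).1
  set G : Euc k → Euc m := fun y => Φ (σ y) with hG
  have hGd : ∀ y ∈ Metric.ball y₀ (C₁ * h), DifferentiableAt ℝ G y := fun y hy =>
    DifferentiableAt.comp y (hΦ _ (hnear y hy)).2.1 (hσd y (hball hy))
  have hGW : ∀ y ∈ Metric.ball y₀ (C₁ * h), G y ∈ slice k m := fun y hy =>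
    (hsl _ (hΦ _ (hnear y hy)).1).mp (hSM (subset_closure (hσ.mapsTo (hball hy))))
  suffices hex : ∃ y ∈ Metric.ball y₀ (C₁ * h), G y = Φ z by
    obtain ⟨y, hy, hyz⟩ := hex
    exact ⟨y, hy, Φ.injOn (hΦ _ (hnear y hy)).1 hzs hyz⟩
  refine exists_mem_ball_eq_of_fderiv (c := A * L) (by positivity) hGd ?_ ?_
  · intro y hy
    obtain ⟨hs, hd1, hd2, hdL, -⟩ := hΦ _ (hnear y hy)
    have hnb : Metric.ball y₀ (C₁ * h) ∈ nhds y := Metric.isOpen_ball.mem_nhds hy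
    -- `σ = Φ⁻¹ ∘ G` near `y`, so `DG(y)` is bounded below
    have hchain : ∀ v, fderiv ℝ σ y v = fderiv ℝ Φ.symm (Φ (σ y)) (fderiv ℝ G y v) := by
      intro v
      have h1 : σ =ᶠ[nhds y] fun u => Φ.symm (G u) := by
        filter_upwards [hnb] with u hu
        exact (Φ.left_inv (hΦ _ (hnear u hu)).1).symm
      have h2 : HasFDerivAt (fun u => Φ.symm (G u))
          ((fderiv ℝ Φ.symm (Φ (σ y))).comp (fderiv ℝ G y)) y :=
        HasFDerivAt.comp (g := Φ.symm) y hd2.hasFDerivAt (hGd y hy).hasFDerivAt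
      rw [h1.fderiv_eq, h2.fderiv]
      rfl
    have hlow : ∀ v, ‖v‖ ≤ A * L * ‖fderiv ℝ G y v‖ := by
      intro v
      calc ‖v‖ ≤ A * ‖fderiv ℝ σ y v‖ := (hσA y (hball hy)).2 v
        _ ≤ A * (L * ‖fderiv ℝ G y v‖) := by
            rw [hchain]
            gcongr
            exact ContinuousLinearMap.le_of_opNorm_le _ hdL _
        _ = _ := by ring
    have hinj : Function.Injective (fderiv ℝ G y).toLinearMap := by
      rw [injective_iff_map_eq_zero]
      intro v hv
      have h1 := hlow v
      rw [show fderiv ℝ G y v = 0 from hv, norm_zero, mul_zero] at h1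
      exact norm_le_zero_iff.mp h1
    obtain ⟨v, hv⟩ := exists_eq_of_mem_slice hinj
      (fun v => fderiv_mem_slice (hGd y hy) (Filter.mem_of_superset hnb hGW) v)
      (Submodule.sub_mem _ ((hsl z hzs).mp hz) (hGW y hy))
    have hv' : fderiv ℝ G y v = Φ z - G y := hv
    refine ⟨v, hv', ?_⟩
    rw [← hv']
    exact hlow v
  · have h1 := (hΦ z hzδ).2.2.2.2
    rw [← dist_eq_norm z, dist_comm] at h1
    calc A * L * ‖Φ z - G y₀‖ ≤ A * L * (L * h) := by
          gcongr
          exact h1.trans (by gcongr)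
      _ < C₁ * h := by
          rw [hC₁]
          nlinarith

/-! ### Series of differentiable functions on an open set -/

section Series

variable {ι E F : Type*} [NormedAddCommGroup E] [NormedSpace ℝ E] [NormedAddCommGroup F]
  [NormedSpace ℝ F] [CompleteSpace F]

theorem hasFDerivAt_tsum_iteratedFDeriv {g : ι → E → F} {U : Set E} (hU : IsOpen U) {q : ℕ}
    {u : ι → ℝ} (hu : Summable u) (hg : ∀ i, ContDiffOn ℝ q (g i) U)
    (hb : ∀ l ≤ q, ∀ i, ∀ y ∈ U, ‖iteratedFDeriv ℝ l (g i) y‖ ≤ u i) {l : ℕ} (hl : l < q) {y : E}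
    (hy : y ∈ U) :
    HasFDerivAt (fun z => ∑' i, iteratedFDeriv ℝ l (g i) z)
      (∑' i, fderiv ℝ (iteratedFDeriv ℝ l (g i)) y) y := by
  obtain ⟨r, hr, hball⟩ := Metric.isOpen_iff.mp hU y hy
  refine hasFDerivAt_tsum_of_isPreconnected hu Metric.isOpen_ball
    (convex_ball y r).isPreconnected (fun i z hz => ?_) (fun i z hz => ?_)
    (Metric.mem_ball_self hr) ?_ (Metric.mem_ball_self hr)
  · exact (((hg i).contDiffAt (hU.mem_nhds (hball hz))).differentiableAt_iteratedFDeriv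
      (by exact_mod_cast hl)).hasFDerivAt
  · rw [norm_fderiv_iteratedFDeriv]
    exact hb (l + 1) hl i z (hball hz)
  · exact Summable.of_norm_bounded hu fun i => hb l hl.le i y hy

theorem iteratedFDeriv_tsum_of_isOpen {g : ι → E → F} {U : Set E} (hU : IsOpen U) {q : ℕ}
    {u : ι → ℝ} (hu : Summable u) (hg : ∀ i, ContDiffOn ℝ q (g i) U)
    (hb : ∀ l ≤ q, ∀ i, ∀ y ∈ U, ‖iteratedFDeriv ℝ l (g i) y‖ ≤ u i) {l : ℕ} (hl : l ≤ q) {y : E}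
    (hy : y ∈ U) :
    iteratedFDeriv ℝ l (fun z => ∑' i, g i z) y = ∑' i, iteratedFDeriv ℝ l (g i) y := by
  induction l generalizing y with
  | zero =>
    simp_rw [iteratedFDeriv_zero_eq_comp]
    exact (continuousMultilinearCurryFin0 ℝ E F).symm.toContinuousLinearEquiv.map_tsum
  | succ l ih =>
    have he : iteratedFDeriv ℝ l (fun z => ∑' i, g i z) =ᶠ[nhds y]
        fun z => ∑' i, iteratedFDeriv ℝ l (g i) z := by
      filter_upwards [hU.mem_nhds hy] with z hz using ih (by omega) hz
    simp_rw [iteratedFDeriv_succ_eq_comp_left, Function.comp_apply]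
    rw [he.fderiv_eq, (hasFDerivAt_tsum_iteratedFDeriv hU hu hg hb hl hy).fderiv]
    exact (continuousMultilinearCurryLeftEquiv ℝ
      (fun _ : Fin (l + 1) => E) F).symm.toContinuousLinearEquiv.map_tsum

theorem contDiffOn_tsum_of_isOpen {g : ι → E → F} {U : Set E} (hU : IsOpen U) {q : ℕ}
    {u : ι → ℝ} (hu : Summable u) (hg : ∀ i, ContDiffOn ℝ q (g i) U)
    (hb : ∀ l ≤ q, ∀ i, ∀ y ∈ U, ‖iteratedFDeriv ℝ l (g i) y‖ ≤ u i) :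
    ContDiffOn ℝ q (fun z => ∑' i, g i z) U := by
  have heq : ∀ l ≤ q, Set.EqOn (iteratedFDerivWithin ℝ l (fun z => ∑' i, g i z) U)
      (fun z => ∑' i, iteratedFDeriv ℝ l (g i) z) U := fun l hl z hz => by
    rw [iteratedFDerivWithin_of_isOpen l hU hz]
    exact iteratedFDeriv_tsum_of_isOpen hU hu hg hb hl hz
  refine contDiffOn_of_continuousOn_differentiableOn (n := (q : ℕ∞)) (fun l hl => ?_)
    fun l hl => ?_
  · have hl' : l ≤ q := by exact_mod_cast hl
    refine ContinuousOn.congr ?_ (heq l hl')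
    refine continuousOn_tsum (fun i => ?_) hu fun i z hz => hb l hl' i z hz
    intro z hz
    exact (((hg i).contDiffAt (hU.mem_nhds hz)).continuousAt_iteratedFDeriv
      (by exact_mod_cast hl')).continuousWithinAt
  · have hl' : l < q := by exact_mod_cast hl
    refine DifferentiableOn.congr (fun z hz => ?_) (heq l hl'.le)
    have h := hasFDerivAt_tsum_iteratedFDeriv hU hu hg hb hl' hz
    exact h.differentiableAt.differentiableWithinAt

theorem norm_iteratedFDeriv_tsum_le {g : ι → E → F} {U : Set E} (hU : IsOpen U) {q : ℕ}
    {u : ι → ℝ} (hu : Summable u) (hg : ∀ i, ContDiffOn ℝ q (g i) U)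
    (hb : ∀ l ≤ q, ∀ i, ∀ y ∈ U, ‖iteratedFDeriv ℝ l (g i) y‖ ≤ u i) {l : ℕ} (hl : l ≤ q) {y : E}
    (hy : y ∈ U) :
    ‖iteratedFDeriv ℝ l (fun z => ∑' i, g i z) y‖ ≤ ∑' i, u i := by
  rw [iteratedFDeriv_tsum_of_isOpen hU hu hg hb hl hy]
  exact tsum_of_norm_bounded hu.hasSum fun i => hb l hl i y hy

end Series

/-- The Cauchy–Schwarz inequality for a square-summable sequence and a square-summable weight. -/
theorem summable_and_tsum_norm_mul_le {w : ℕ → ℝ} (hw0 : ∀ n, 0 ≤ w n)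
    (hw : Summable fun n => w n ^ 2) (b : lp (fun _ : ℕ => ℂ) 2) :
    (Summable fun n => ‖b n‖ * w n) ∧ ∑' n, ‖b n‖ * w n ≤ ‖b‖ * √(∑' n, w n ^ 2) := by
  have hb : Summable fun n => ‖b n‖ ^ (2 : ℝ) := by
    simpa using (lp.memℓp b).summable (by simp)
  have hw' : Summable fun n => w n ^ (2 : ℝ) := by simpa using hw
  have hconj : Real.HolderConjugate 2 2 := Real.HolderConjugate.two_two
  refine ⟨Real.summable_mul_of_Lp_Lq_of_nonneg hconj (fun n => norm_nonneg _) hw0 hb hw', ?_⟩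
  refine (Real.inner_le_Lp_mul_Lq_tsum_of_nonneg hconj (fun n => norm_nonneg _) hw0 hb hw').trans
    (le_of_eq ?_)
  have h1 : ‖b‖ = (∑' n, ‖b n‖ ^ (2 : ℝ)) ^ (1 / 2 : ℝ) := by
    simpa using lp.norm_eq_tsum_rpow (p := 2) (by simp) b
  rw [← h1, Real.sqrt_eq_rpow]
  simp

/-! ### Derivatives of the Fourier modes and of the elements of the native space -/

theorem pderiv_const_mul_mode {m : ℕ} (ω : Euc m) (a : ℂ) (i : Fin m) :
    pderiv i (fun x => a * mode ω x) = fun x => a * (Complex.I * (ω i : ℂ)) * mode ω x := by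
  funext x
  unfold pderiv
  have h1 : HasFDerivAt (fun x : Euc m => Complex.I * ((inner ℝ ω x : ℝ) : ℂ))
      (Complex.I • (Complex.ofRealCLM.comp (innerSL ℝ ω))) x := by
    have h2 : HasFDerivAt (fun x : Euc m => ((inner ℝ ω x : ℝ) : ℂ))
        (Complex.ofRealCLM.comp (innerSL ℝ ω)) x :=
      (Complex.ofRealCLM.comp (innerSL ℝ ω)).hasFDerivAt
    exact h2.const_mul Complex.I
  have h3 : HasFDerivAt (fun x => a * mode ω x) _ x := (h1.cexp).const_mul a
  rw [h3.fderiv]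
  simp [mode, EuclideanSpace.inner_single_right]
  ring

theorem multiDeriv_mode {m : ℕ} (ω : Euc m) (α : Fin m → ℕ) :
    multiDeriv α (mode ω) = fun x => (∏ i, (Complex.I * (ω i : ℂ)) ^ α i) * mode ω x := by
  have hlist : ∀ L : List (Fin m), listDeriv L (mode ω)
      = fun x => (L.map fun i => Complex.I * (ω i : ℂ)).prod * mode ω x := by
    intro L
    induction L with
    | nil => simp [listDeriv]
    | cons i L ih =>
      rw [listDeriv_cons, ih, pderiv_const_mul_mode]
      funext x
      rw [List.map_cons, List.prod_cons]
      ring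
  rw [multiDeriv_eq_listDeriv, hlist]
  funext x
  congr 1
  unfold multiList
  rw [List.map_flatMap, List.flatMap_def, List.prod_flatten, List.map_map, Fin.prod_univ_def]
  congr 1
  refine List.map_congr_left fun i _ => ?_
  simp

theorem norm_mode {m : ℕ} (ω x : Euc m) : ‖mode ω x‖ = 1 := by
  unfold mode
  rw [mul_comm]
  exact Complex.norm_exp_ofReal_mul_I _

theorem contDiff_mode {m : ℕ} (ω : Euc m) {r : WithTop ℕ∞} : ContDiff ℝ r (mode ω) := by
  unfold mode
  have h1 : ContDiff ℝ r fun x : Euc m => ((inner ℝ ω x : ℝ) : ℂ) :=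
    (Complex.ofRealCLM.comp (innerSL ℝ ω)).contDiff
  exact (contDiff_const.mul h1).cexp

theorem norm_iteratedFDeriv_mode_le {m : ℕ} (ω x : Euc m) (l : ℕ) :
    ‖iteratedFDeriv ℝ l (mode ω) x‖ ≤ (m : ℝ) ^ l * ‖ω‖ ^ l := by
  refine norm_iteratedFDeriv_le_of_multiDeriv isOpen_univ (contDiff_mode ω).contDiffOn
    (Set.mem_univ x) fun α hα => ?_
  rw [multiDeriv_mode, norm_mul, norm_mode, mul_one, norm_prod, ← hα, ← Finset.prod_pow_eq_pow_sum]
  refine Finset.prod_le_prod (fun _ _ => norm_nonneg _) fun i _ => ?_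
  rw [norm_pow, norm_mul, Complex.norm_I, one_mul, Complex.norm_real]
  gcongr
  exact PiLp.norm_apply_le _ _

theorem contDiffOn_diffOp_mode {m p q : ℕ} {c : (Fin m → ℕ) → Euc m → ℂ} {V : Set (Euc m)}
    (hc : ∀ α ∈ multiIdx m p, ContDiffOn ℝ q (c α) V) (ω : Euc m) :
    ContDiffOn ℝ q (diffOp p c (mode ω)) V := by
  unfold diffOp
  refine ContDiffOn.sum fun α hα => (hc α hα).mul ?_
  rw [multiDeriv_mode]
  exact (contDiff_const.mul (contDiff_mode ω)).contDiffOn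

/-- The nonzero frequencies of the lattice are bounded away from zero. -/
theorem exists_le_norm_freq {m : ℕ} {lo hi : Fin m → ℝ} (hbox : ∀ i, lo i < hi i)
    (e : ℕ ≃ (Fin m → ℤ)) : ∃ δ > 0, ∀ n, n ≠ e.symm 0 → δ ≤ ‖freq lo hi e n‖ := by
  have hnn : ∀ i, 0 ≤ hi i - lo i := fun i => (sub_pos.mpr (hbox i)).le
  have hsum : 0 ≤ ∑ i, (hi i - lo i) := Finset.sum_nonneg fun i _ => hnn i
  refine ⟨2 * Real.pi / (1 + ∑ i, (hi i - lo i)), by positivity, fun n hn => ?_⟩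
  obtain ⟨i, hi0⟩ : ∃ i, e n i ≠ 0 := by
    by_contra! h
    exact hn (e.eq_symm_apply.mpr (funext h))
  have hi1 : (1 : ℝ) ≤ |(e n i : ℝ)| := by
    exact_mod_cast Int.one_le_abs hi0
  have hle : hi i - lo i ≤ 1 + ∑ i, (hi i - lo i) := by
    have := Finset.single_le_sum (f := fun i => hi i - lo i) (fun i _ => hnn i)
      (Finset.mem_univ i)
    linarith
  have hpos : 0 < hi i - lo i := sub_pos.mpr (hbox i)
  calc 2 * Real.pi / (1 + ∑ i, (hi i - lo i)) ≤ 2 * Real.pi * |(e n i : ℝ)| / (hi i - lo i) := by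
        exact div_le_div₀ (by positivity) (le_mul_of_one_le_right (by positivity) hi1) hpos hle
    _ = ‖(freq lo hi e n) i‖ := by
        simp only [freq, Real.norm_eq_abs]
        rw [abs_div, abs_mul, abs_of_pos hpos, abs_of_pos (by positivity : 0 < 2 * Real.pi)]
    _ ≤ _ := PiLp.norm_apply_le _ _

theorem wt_pos {d : ℕ → ℝ} (hd : ∀ n, 0 < d n) (n : ℕ) : 0 < wt d n := Real.rpow_pos_of_pos (hd n) _

theorem summable_norm_freq_pow {m p : ℕ} {lo hi : Fin m → ℝ} (hbox : ∀ i, lo i < hi i)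
    (e : ℕ ≃ (Fin m → ℤ)) {d : ℕ → ℝ} (hd : ∀ n, 0 < d n)
    (hdp : Memℓp (fun n => ‖freq lo hi e n‖ ^ p * wt d n) 2) (b : lp (fun _ : ℕ => ℂ) 2) {l : ℕ}
    (hl : l ≤ p) : Summable fun n => ‖b n‖ * (‖freq lo hi e n‖ ^ l * wt d n) := by
  have hwt := fun n => (wt_pos hd n).le
  have hsq : Summable fun n => (‖freq lo hi e n‖ ^ p * wt d n) ^ 2 := by
    have h := hdp.summable (by simp)
    simpa only [ENNReal.toReal_ofNat, Real.rpow_ofNat, Real.norm_eq_abs, sq_abs] using h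
  obtain ⟨hs, -⟩ := summable_and_tsum_norm_mul_le
    (fun n => mul_nonneg (pow_nonneg (norm_nonneg _) _) (hwt n)) hsq b
  obtain ⟨δ, hδ, hfreq⟩ := exists_le_norm_freq hbox e
  refine Summable.of_norm_bounded_eventually (hs.mul_left ((δ ^ (p - l))⁻¹)) ?_
  have hcof : ∀ᶠ n in Filter.cofinite, n ≠ e.symm 0 := by
    simp [Filter.eventually_cofinite]
  filter_upwards [hcof] with n hn
  rw [Real.norm_of_nonneg (mul_nonneg (norm_nonneg _)
    (mul_nonneg (pow_nonneg (norm_nonneg _) _) (hwt n)))]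
  rw [le_inv_mul_iff₀ (by positivity)]
  have h1 : δ ^ (p - l) * ‖freq lo hi e n‖ ^ l ≤ ‖freq lo hi e n‖ ^ p := by
    calc _ ≤ ‖freq lo hi e n‖ ^ (p - l) * ‖freq lo hi e n‖ ^ l := by
          gcongr
          exact hfreq n hn
      _ = _ := by rw [← pow_add, Nat.sub_add_cancel hl]
  calc _ = ‖b n‖ * (δ ^ (p - l) * ‖freq lo hi e n‖ ^ l * wt d n) := by ring
    _ ≤ _ := by
        have := hwt n
        gcongr

/-- A differential operator of order at most `p` acts term by term on the native space. -/
theorem hasSum_diffOp_synth {m p : ℕ} {lo hi : Fin m → ℝ} (hbox : ∀ i, lo i < hi i)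
    (e : ℕ ≃ (Fin m → ℤ)) {d : ℕ → ℝ} (hd : ∀ n, 0 < d n)
    (hdp : Memℓp (fun n => ‖freq lo hi e n‖ ^ p * wt d n) 2) (c : (Fin m → ℕ) → Euc m → ℂ)
    (b : lp (fun _ : ℕ => ℂ) 2) (x : Euc m) :
    HasSum (fun n => (wt d n : ℂ) * b n * diffOp p c (mode (freq lo hi e n)) x)
      (diffOp p c (synth (freq lo hi e) d b) x) := by
  set ω := freq lo hi e with hω
  set g : ℕ → Euc m → ℂ := fun n x => ((wt d n : ℂ) * b n) • mode (ω n) x with hg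
  set u : ℕ → ℝ := fun n => ∑ l ∈ Finset.range (p + 1),
    (m : ℝ) ^ l * (‖b n‖ * (‖ω n‖ ^ l * wt d n)) with hudef
  have hu : Summable u := summable_sum fun l hl =>
    (summable_norm_freq_pow hbox e hd hdp b (by
      rw [Finset.mem_range] at hl
      omega)).mul_left _
  have hsmooth : ∀ n, ContDiff ℝ p (g n) := fun n => (contDiff_mode _).const_smul _
  have hgder : ∀ n l y, iteratedFDeriv ℝ l (g n) y
      = ((wt d n : ℂ) * b n) • iteratedFDeriv ℝ l (mode (ω n)) y := fun n l y =>
    iteratedFDeriv_const_smul_apply (a := (wt d n : ℂ) * b n) (f := mode (ω n))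
      (contDiff_mode _).contDiffAt
  have hbound : ∀ l ≤ p, ∀ n, ∀ y ∈ Set.univ, ‖iteratedFDeriv ℝ l (g n) y‖ ≤ u n := by
    intro l hl n y _
    have hwt := (wt_pos hd n).le
    rw [hgder, norm_smul, norm_mul, Complex.norm_real, Real.norm_of_nonneg hwt]
    refine le_trans ?_ (Finset.single_le_sum
      (f := fun l => (m : ℝ) ^ l * (‖b n‖ * (‖ω n‖ ^ l * wt d n))) (fun l _ => by positivity)
      (Finset.mem_range.mpr (Nat.lt_succ_of_le hl)))
    calc _ ≤ wt d n * ‖b n‖ * ((m : ℝ) ^ l * ‖ω n‖ ^ l) := by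
          gcongr
          exact norm_iteratedFDeriv_mode_le _ _ _
      _ = _ := by ring
  have hsynth : synth ω d b = fun x => ∑' n, g n x := rfl
  have hterm : ∀ α ∈ multiIdx m p,
      HasSum (fun n => (wt d n : ℂ) * b n * multiDeriv α (mode (ω n)) x)
        (multiDeriv α (synth ω d b) x) := by
    intro α hα
    rw [mem_multiIdx] at hα
    obtain ⟨i, hi⟩ := exists_occ_eq (rfl : ∑ j, α j = _)
    have hcd := contDiffOn_tsum_of_isOpen isOpen_univ hu (fun n => (hsmooth n).contDiffOn) hbound
    have h1 := iteratedFDeriv_single_eq_multiDeriv isOpen_univ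
      (hcd.of_le (by exact_mod_cast hα)) i (Set.mem_univ x)
    rw [iteratedFDeriv_tsum_of_isOpen isOpen_univ hu (fun n => (hsmooth n).contDiffOn) hbound hα
      (Set.mem_univ x), hi, ← hsynth] at h1
    have hs : Summable fun n => iteratedFDeriv ℝ (∑ j, α j) (g n) x :=
      Summable.of_norm_bounded hu fun n => hbound _ hα n x (Set.mem_univ x)
    have h2 := ContinuousMultilinearMap.hasSum_eval hs.hasSum
      fun k => EuclideanSpace.single (i k) (1 : ℝ)
    rw [h1] at h2
    refine (congrArg (HasSum · _) (funext fun n => ?_)).mpr h2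
    rw [hgder, smul_apply, iteratedFDeriv_single_eq_multiDeriv
      isOpen_univ (contDiff_mode _).contDiffOn i (Set.mem_univ x), hi, smul_eq_mul]
  have hsum := hasSum_sum fun α hα => (hterm α hα).mul_left (c α x)
  change HasSum _ (∑ α ∈ multiIdx m p, c α x * multiDeriv α (synth ω d b) x)
  refine (congrArg (HasSum · _) (funext fun n => ?_)).mpr hsum
  unfold diffOp
  rw [Finset.mul_sum]
  refine Finset.sum_congr rfl fun α _ => ?_
  ring

/-! ### Series with square-summable suprema of derivatives -/

theorem norm_multiDeriv_le_derivSup {m q : ℕ} {S : Set (Euc m)} {g : Euc m → ℂ}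
    (hg : derivSup q S g ≠ ⊤) {β : Fin m → ℕ} (hβ : ∑ i, β i ≤ q) {x : Euc m} (hx : x ∈ S) :
    ‖multiDeriv β g x‖ ≤ (derivSup q S g).toReal := by
  rw [← toReal_enorm]
  refine ENNReal.toReal_mono hg ?_
  unfold derivSup
  exact le_iSup₂_of_le β (mem_multiIdx.mpr hβ) (le_iSup₂_of_le x hx le_rfl)

theorem derivSup_ne_top {m q : ℕ} {S : Set (Euc m)} {d : ℕ → ℝ} (hd : ∀ n, 0 < d n)
    {G : ℕ → Euc m → ℂ}
    (hF : ∑' n, (derivSup q S (G n) * ENNReal.ofReal (wt d n)) ^ 2 < ⊤) (n : ℕ) :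
    derivSup q S (G n) ≠ ⊤ := by
  intro h
  refine ENNReal.ne_top_of_tsum_ne_top hF.ne n ?_
  rw [h, ENNReal.top_mul (by simpa using wt_pos hd n)]
  simp

theorem summable_derivSup {m q : ℕ} {S : Set (Euc m)} {d : ℕ → ℝ} (hd : ∀ n, 0 < d n)
    {G : ℕ → Euc m → ℂ}
    (hF : ∑' n, (derivSup q S (G n) * ENNReal.ofReal (wt d n)) ^ 2 < ⊤) :
    Summable fun n => ((derivSup q S (G n)).toReal * wt d n) ^ 2 := by
  have h := ENNReal.summable_toReal hF.ne
  convert h using 2 with n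
  rw [ENNReal.toReal_pow, ENNReal.toReal_mul, ENNReal.toReal_ofReal (wt_pos hd n).le]

theorem continuousOn_series {m q : ℕ} {S V : Set (Euc m)} (hSV : S ⊆ V) {d : ℕ → ℝ}
    (hd : ∀ n, 0 < d n) {G : ℕ → Euc m → ℂ} (hG : ∀ n, ContDiffOn ℝ q (G n) V)
    (hF : ∑' n, (derivSup q S (G n) * ENNReal.ofReal (wt d n)) ^ 2 < ⊤)
    (b : lp (fun _ : ℕ => ℂ) 2) :
    ContinuousOn (fun x => ∑' n, (wt d n : ℂ) * b n * G n x) S := by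
  have hwt := fun n => (wt_pos hd n).le
  obtain ⟨hs, -⟩ := summable_and_tsum_norm_mul_le
    (fun n => mul_nonneg ENNReal.toReal_nonneg (hwt n)) (summable_derivSup hd hF) b
  refine continuousOn_tsum (fun n => continuousOn_const.mul ((hG n).continuousOn.mono hSV)) hs
    fun n x hx => ?_
  have h1 := norm_multiDeriv_le_derivSup (derivSup_ne_top hd hF n) (β := 0) (by simp) hx
  rw [multiDeriv_zero] at h1
  rw [norm_mul, norm_mul, Complex.norm_real, Real.norm_of_nonneg (hwt n)]
  calc _ ≤ wt d n * ‖b n‖ * (derivSup q S (G n)).toReal := by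
        have := hwt n
        gcongr
    _ = _ := by ring

/-- On the domain of a chart, the pulled back series is of class `C^q`, and its derivatives are
bounded by the `ℓ²` norm of the coefficients. -/
theorem IsChart.exists_series_bound {k m q : ℕ} {S V : Set (Euc m)} (hV : IsOpen V) (hSV : S ⊆ V)
    {U : Set (Euc k)} {σ : Euc k → Euc m} (hσ : IsChart q S U σ) {d : ℕ → ℝ}
    (hd : ∀ n, 0 < d n) {G : ℕ → Euc m → ℂ} (hG : ∀ n, ContDiffOn ℝ q (G n) V)
    (hF : ∑' n, (derivSup q S (G n) * ENNReal.ofReal (wt d n)) ^ 2 < ⊤) :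
    ∃ C ≥ 0, ∀ b : lp (fun _ : ℕ => ℂ) 2,
      ContDiffOn ℝ q (fun y => ∑' n, (wt d n : ℂ) * b n * G n (σ y)) U ∧
      ∀ l ≤ q, ∀ y ∈ U,
        ‖iteratedFDeriv ℝ l (fun y => ∑' n, (wt d n : ℂ) * b n * G n (σ y)) y‖ ≤ C * ‖b‖ := by
  have hwt := fun n => (wt_pos hd n).le
  obtain ⟨A, hA⟩ := hσ.bounded
  set A' := max A 1 with hA'
  have hA'1 : 1 ≤ A' := le_max_right _ _
  set D : ℕ → ℝ := fun n => (derivSup q S (G n)).toReal with hD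
  have hD0 : ∀ n, 0 ≤ D n := fun n => ENNReal.toReal_nonneg
  set C₀ : ℝ := q.factorial * (m + 1) ^ q * A' ^ q with hC₀
  have hC₀0 : 0 ≤ C₀ := by positivity
  have hVS : Set.MapsTo σ U V := fun y hy => hSV (hσ.mapsTo hy)
  have hcomp : ∀ n, ContDiffOn ℝ q (fun y => G n (σ y)) U := fun n =>
    (hG n).comp hσ.contDiffOn hVS
  have hcb : ∀ n, ∀ l ≤ q, ∀ y ∈ U, ‖iteratedFDeriv ℝ l (fun y => G n (σ y)) y‖ ≤ C₀ * D n := by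
    intro n l hl y hy
    have hin : ∀ i ≤ l, ‖iteratedFDerivWithin ℝ i (G n) V (σ y)‖ ≤ (m + 1) ^ q * D n := by
      intro i hi
      rw [iteratedFDerivWithin_of_isOpen i hV (hVS hy)]
      refine (norm_iteratedFDeriv_le_of_multiDeriv hV
        ((hG n).of_le (by exact_mod_cast hi.trans hl)) (hVS hy) (D := D n) fun β hβ =>
          norm_multiDeriv_le_derivSup (derivSup_ne_top hd hF n) (by omega)
            (hσ.mapsTo hy)).trans ?_
      have h1 : (m : ℝ) ^ i ≤ (m + 1) ^ q :=
        (pow_le_pow_left₀ (by positivity) (by linarith) i).trans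
          (pow_le_pow_right₀ (by linarith [(Nat.cast_nonneg m : (0 : ℝ) ≤ m)]) (hi.trans hl))
      exact mul_le_mul_of_nonneg_right h1 (hD0 n)
    have hout : ∀ i, 1 ≤ i → i ≤ l → ‖iteratedFDerivWithin ℝ i σ U y‖ ≤ A' ^ i := by
      intro i hi1 hi
      rw [iteratedFDerivWithin_of_isOpen i hσ.isOpen hy]
      exact ((hA i (hi.trans hl) y hy).trans (le_max_left _ _)).trans
        (le_self_pow₀ hA'1 (by omega))
    have h := norm_iteratedFDerivWithin_comp_le (hG n) hσ.contDiffOn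
      (by exact_mod_cast hl) hV.uniqueDiffOn hσ.isOpen.uniqueDiffOn hVS hy hin hout
    rw [iteratedFDerivWithin_of_isOpen l hσ.isOpen hy] at h
    refine h.trans ?_
    have hf : (l.factorial : ℝ) ≤ q.factorial := by exact_mod_cast Nat.factorial_le hl
    have hp : A' ^ l ≤ A' ^ q := pow_le_pow_right₀ hA'1 hl
    have := hD0 n
    calc _ ≤ (q.factorial : ℝ) * ((m + 1) ^ q * D n) * A' ^ q := by gcongr
      _ = _ := by
        rw [hC₀]
        ring
  refine ⟨C₀ * √(∑' n, (D n * wt d n) ^ 2), by positivity, fun b => ?_⟩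
  obtain ⟨hs, hle⟩ := summable_and_tsum_norm_mul_le
    (fun n => mul_nonneg (hD0 n) (hwt n)) (summable_derivSup hd hF) b
  have hg : ∀ n, ContDiffOn ℝ q (fun y => (wt d n : ℂ) * b n * G n (σ y)) U := fun n =>
    contDiffOn_const.mul (hcomp n)
  have hbound : ∀ l ≤ q, ∀ n, ∀ y ∈ U,
      ‖iteratedFDeriv ℝ l (fun y => (wt d n : ℂ) * b n * G n (σ y)) y‖
        ≤ C₀ * (‖b n‖ * (D n * wt d n)) := by
    intro l hl n y hy
    have h1 : iteratedFDeriv ℝ l (fun y => (wt d n : ℂ) * b n * G n (σ y)) y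
        = ((wt d n : ℂ) * b n) • iteratedFDeriv ℝ l (fun y => G n (σ y)) y :=
      iteratedFDeriv_const_smul_apply (a := (wt d n : ℂ) * b n) (f := fun y => G n (σ y))
        (((hcomp n).contDiffAt (hσ.isOpen.mem_nhds hy)).of_le (by exact_mod_cast hl))
    rw [h1, norm_smul, norm_mul, Complex.norm_real, Real.norm_of_nonneg (hwt n)]
    calc _ ≤ wt d n * ‖b n‖ * (C₀ * D n) := by
          have := hwt n
          gcongr
          exact hcb n l hl y hy
      _ = _ := by ring
  refine ⟨contDiffOn_tsum_of_isOpen hσ.isOpen (hs.mul_left C₀) hg hbound, fun l hl y hy => ?_⟩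
  refine (norm_iteratedFDeriv_tsum_le hσ.isOpen (hs.mul_left C₀) hg hbound hl hy).trans ?_
  rw [tsum_mul_left]
  calc _ ≤ C₀ * (‖b‖ * √(∑' n, (D n * wt d n) ^ 2)) := by gcongr
    _ = _ := by ring

/-! ### The error estimate -/

/-- The error estimate on one chart, for a series that vanishes on the point cloud. -/
theorem IsChart.exists_error_bound {k m q : ℕ} (hq : 1 ≤ q) {S V M : Set (Euc m)}
    (hS : IsCompact (closure S)) (hM : IsSubmanifold k M) (hSM : closure S ⊆ M)
    (hV : IsOpen V) (hSV : S ⊆ V) {U : Set (Euc k)} {σ : Euc k → Euc m} (hσ : IsChart q S U σ)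
    {d : ℕ → ℝ} (hd : ∀ n, 0 < d n) {G : ℕ → Euc m → ℂ} (hG : ∀ n, ContDiffOn ℝ q (G n) V)
    (hF : ∑' n, (derivSup q S (G n) * ENNReal.ofReal (wt d n)) ^ 2 < ⊤) :
    ∃ h₁ > 0, ∃ B > 0, ∀ b : lp (fun _ : ℕ => ℂ) 2,
      ContDiffOn ℝ q (fun y => ∑' n, (wt d n : ℂ) * b n * G n (σ y)) U ∧
      ∀ h, 0 < h → h ≤ h₁ → ∀ X : Set (Euc m), X ⊆ S → (∀ x ∈ S, ∃ z ∈ X, dist x z ≤ h) →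
        (∀ z ∈ X, ∑' n, (wt d n : ℂ) * b n * G n z = 0) →
        ∀ α : Fin k → ℕ, ∑ i, α i ≤ q → ∀ y ∈ U,
          ‖multiDeriv α (fun y => ∑' n, (wt d n : ℂ) * b n * G n (σ y)) y‖
            ≤ B * ‖b‖ * h ^ (q - ∑ i, α i) := by
  obtain ⟨h₁, hh₁, C₁, hC₁, hfill⟩ := hσ.exists_mem_ball_eq hq hS hM hSM
  obtain ⟨h₂, hh₂, C₂, hC₂, hsamp⟩ := norm_multiDeriv_le_of_zeros hq hσ.isOpen hσ.cone hC₁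
  obtain ⟨C, hC, hser⟩ := hσ.exists_series_bound hV hSV hd hG hF
  refine ⟨min h₁ h₂, lt_min hh₁ hh₂, C₂ * C + 1, by positivity, fun b => ⟨(hser b).1, ?_⟩⟩
  intro h hh hle X hXS hX hzero α hα y hy
  refine (hsamp h hh (hle.trans (min_le_right _ _)) _ (hser b).1 (C * ‖b‖) (hser b).2
    (fun y₀ hball => ?_) α hα y hy).trans ?_
  · obtain ⟨z, hz, hdist⟩ := hX (σ y₀)
      (hσ.mapsTo (hball (Metric.mem_ball_self (by positivity))))
    obtain ⟨y', hy', rfl⟩ := hfill h hh (hle.trans (min_le_left _ _)) y₀ hball z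
      (hSM (subset_closure (hXS hz))) hdist
    exact ⟨y', hy', hzero _ hz⟩
  · rw [← mul_assoc]
    gcongr
    linarith

theorem isCompact_closure_of_subset_box {m : ℕ} {lo hi : Fin m → ℝ} {S : Set (Euc m)}
    (hS : S ⊆ box lo hi) : IsCompact (closure S) := by
  have hsub : S ⊆ WithLp.toLp 2 '' Set.Icc lo hi := fun x hx =>
    ⟨x.ofLp, ⟨fun i => (hS hx i).1, fun i => (hS hx i).2⟩, rfl⟩
  exact (isCompact_Icc.image (PiLp.continuous_toLp 2 _)).closure_of_subset hsub

theorem exists_dist_le_hmax {m N : ℕ} {S : Fin N → Set (Euc m)} {X : Fin N → Finset (Euc m)}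
    (h : hmax S X ≠ ⊤) (j : Fin N) {x : Euc m} (hx : x ∈ S j) :
    ∃ z ∈ X j, dist x z ≤ (hmax S X).toReal := by
  have h1 : ⨅ z ∈ X j, edist x z ≤ hmax S X :=
    le_iSup_of_le (f := fun i => fillDist (S i) (X i)) j
      (le_iSup₂_of_le (f := fun x _ => ⨅ z ∈ X j, edist x z) x hx le_rfl)
  have hne : (X j).Nonempty := by
    by_contra hemp
    rw [Finset.not_nonempty_iff_eq_empty] at hemp
    simp only [hemp, Finset.notMem_empty, iInf_false, iInf_top, top_le_iff] at h1
    exact h h1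
  obtain ⟨z, hz, hmin⟩ := (X j).exists_min_image (fun z => edist x z) hne
  refine ⟨z, hz, ?_⟩
  rw [dist_edist]
  exact ENNReal.toReal_mono h ((le_iInf₂ hmin).trans h1)

/-- The image of a nonempty chart domain is infinite, so finite clouds have a positive fill
distance. -/
theorem IsChart.hmax_toReal_pos {k m q N : ℕ} (hk : 1 ≤ k) {S : Fin N → Set (Euc m)}
    {X : Fin N → Finset (Euc m)} (h : hmax S X ≠ ⊤) {j : Fin N} {U : Set (Euc k)}
    {σ : Euc k → Euc m} (hσ : IsChart q (S j) U σ) (hU : U.Nonempty) :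
    0 < (hmax S X).toReal := by
  refine lt_of_le_of_ne ENNReal.toReal_nonneg fun h0 => ?_
  have hsub : S j ⊆ X j := fun x hx => by
    obtain ⟨z, hz, hdist⟩ := exists_dist_le_hmax h j hx
    rw [← h0] at hdist
    rwa [dist_le_zero.mp hdist]
  obtain ⟨y, hy⟩ := hU
  have : Nonempty (Fin k) := ⟨⟨0, hk⟩⟩
  have hinf : U.Infinite := infinite_of_mem_nhds y (hσ.isOpen.mem_nhds hy)
  exact hinf (Set.Finite.of_injOn hσ.mapsTo hσ.injOn ((X j).finite_toSet.subset hsub))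

theorem exists_pos_forall_le {K : ℕ} {h : Fin K → ℝ} (hh : ∀ k, 0 < h k) :
    ∃ h₀, 0 < h₀ ∧ h₀ ≤ 1 ∧ ∀ k, h₀ ≤ h k := by
  have hnn : ∀ k, 0 ≤ (h k)⁻¹ := fun k => (inv_pos.mpr (hh k)).le
  have hsum : 0 ≤ ∑ k, (h k)⁻¹ := Finset.sum_nonneg fun k _ => hnn k
  refine ⟨(1 + ∑ k, (h k)⁻¹)⁻¹, by positivity, inv_le_one_of_one_le₀ (by linarith), fun k => ?_⟩
  rw [inv_le_comm₀ (by positivity) (hh k)]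
  have := Finset.single_le_sum (f := fun k => (h k)⁻¹) (fun k _ => hnn k) (Finset.mem_univ k)
  linarith

/-- In the regime `h ≤ 1`, the rate `h^(q-l)` is at least as good as `h^(q-t/2-l)`. -/
theorem pow_sub_le_rpow {h : ℝ} (hh : 0 < h) (hh1 : h ≤ 1) {q l : ℕ} (hl : l ≤ q) (t : ℕ) :
    h ^ (q - l) ≤ h ^ ((q : ℝ) - (t : ℝ) / 2 - (l : ℝ)) := by
  rw [← Real.rpow_natCast, Nat.cast_sub hl]
  refine Real.rpow_le_rpow_of_exponent_ge hh hh1 ?_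
  have : (0 : ℝ) ≤ t := Nat.cast_nonneg t
  linarith

end HBExt

theorem proposition3p3
    {m N p : ℕ}
    -- the box, its Fourier frequencies, and the weights
    (lo hi : Fin m → ℝ) (hbox : ∀ i, lo i < hi i) (e : ℕ ≃ (Fin m → ℤ))
    (d : ℕ → ℝ) (hd : ∀ n, 0 < d n)
    (hdp : Memℓp (fun n => ‖HBExt.freq lo hi e n‖ ^ p * HBExt.wt d n) 2)
    -- the domains and the differential operators of order at most `p`
    (S : Fin N → Set (HBExt.Euc m)) (hS : ∀ i, S i ⊆ HBExt.box lo hi)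
    (c : Fin N → (Fin m → ℕ) → HBExt.Euc m → ℂ)
    -- the fixed index `j`, with the assumptions on the `j`-th domain
    (j : Fin N) (q mj K : ℕ) (hq : 1 ≤ q) (hmj : 1 ≤ mj)
    (M : Set (HBExt.Euc m)) (hM : HBExt.IsSubmanifold mj M) (hSM : closure (S j) ⊆ M)
    (U : Fin K → Set (HBExt.Euc mj)) (σ : Fin K → HBExt.Euc mj → HBExt.Euc m)
    (hσ : ∀ k, HBExt.IsChart q (S j) (U k) (σ k))
    (hcover : S j ⊆ closure (⋃ k, σ k '' U k))
    -- the coefficients of the `j`-th operator are `C^q` near the `j`-th domain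
    (V : Set (HBExt.Euc m)) (hV : IsOpen V) (hSV : S j ⊆ V)
    (hc : ∀ α ∈ HBExt.multiIdx m p, ContDiffOn ℝ q (c j α) V)
    -- the decay condition `F^{(j,q)} d^{-1/2} ∈ ℓ²`
    (hF : ∑' n, (HBExt.derivSup q (S j)
        (HBExt.diffOp p (c j) (HBExt.mode (HBExt.freq lo hi e n))) *
          ENNReal.ofReal (HBExt.wt d n)) ^ 2 < ⊤) :
    ∃ h₀ : ℝ, 0 < h₀ ∧ ∃ B : Fin K → ℕ → ℝ, (∀ k l, 0 < B k l) ∧ ∃ B' : ℝ, 0 < B' ∧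
      ∀ X : Fin N → Finset (HBExt.Euc m), (∀ i, (X i : Set (HBExt.Euc m)) ⊆ S i) →
        HBExt.hmax S X ≤ ENNReal.ofReal h₀ →
      ∀ (f : Fin N → HBExt.Euc m → ℂ) (b b' : lp (fun _ : ℕ => ℂ) 2),
        -- `u = synth b` solves the problem, and `ũ = synth b'` is the minimal norm interpolant
        (∀ i, ∀ x ∈ S i,
          HBExt.diffOp p (c i) (HBExt.synth (HBExt.freq lo hi e) d b) x = f i x) →
        HBExt.IsMinNorm (HBExt.freq lo hi e) d p c X f b' →
        (∀ k,
          ContDiffOn ℝ q (fun y =>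
            HBExt.diffOp p (c j) (HBExt.synth (HBExt.freq lo hi e) d b') (σ k y) -
              f j (σ k y)) (U k) ∧
          ∀ α : Fin mj → ℕ, ∑ i, α i ≤ q → ∀ y ∈ U k,
            ‖HBExt.multiDeriv α (fun y =>
              HBExt.diffOp p (c j) (HBExt.synth (HBExt.freq lo hi e) d b') (σ k y) -
                f j (σ k y)) y‖ ≤
              B k (∑ i, α i) *
                (HBExt.hmax S X).toReal ^ ((q : ℝ) - (mj : ℝ) / 2 - ((∑ i, α i : ℕ) : ℝ)) * ‖b‖) ∧
        ∀ x ∈ S j,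
          ‖HBExt.diffOp p (c j) (HBExt.synth (HBExt.freq lo hi e) d b') x - f j x‖ ≤
            B' * (HBExt.hmax S X).toReal ^ ((q : ℝ) - (mj : ℝ) / 2) * ‖b‖ := by
  have hcomp := HBExt.isCompact_closure_of_subset_box (hS j)
  set G : ℕ → HBExt.Euc m → ℂ :=
    fun n => HBExt.diffOp p (c j) (HBExt.mode (HBExt.freq lo hi e n)) with hGdef
  have hG : ∀ n, ContDiffOn ℝ q (G n) V := fun n => HBExt.contDiffOn_diffOp_mode hc _
  choose h₁ hh₁ B₁ hB₁ hchart using fun k =>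
    (hσ k).exists_error_bound hq hcomp hM hSM hV hSV hd hG hF
  obtain ⟨h₀, hh₀, hh₀1, hh₀le⟩ := HBExt.exists_pos_forall_le hh₁
  refine ⟨h₀, hh₀, fun k _ => 2 * B₁ k, fun k _ => mul_pos two_pos (hB₁ k),
    1 + ∑ k, 2 * B₁ k, ?_, ?_⟩
  · have : 0 ≤ ∑ k, 2 * B₁ k := Finset.sum_nonneg fun k _ => (mul_pos two_pos (hB₁ k)).le
    linarith
  intro X hXS hle f b b' hu hmin
  have htop : HBExt.hmax S X ≠ ⊤ := ne_top_of_le_ne_top ENNReal.ofReal_ne_top hle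
  set h := (HBExt.hmax S X).toReal with hh
  have hhh₀ : h ≤ h₀ := ENNReal.toReal_le_of_le_ofReal hh₀.le hle
  have hsum := fun (i : Fin N) (b : lp (fun _ : ℕ => ℂ) 2) (x : HBExt.Euc m) =>
    HBExt.hasSum_diffOp_synth hbox e hd hdp (c i) b x
  have hfeas : HBExt.Feasible (HBExt.freq lo hi e) d p c X f b := fun i x hx => by
    rw [(hsum i b x).tsum_eq]
    exact hu i x (hXS i hx)
  have hnorm : ‖b' - b‖ ≤ 2 * ‖b‖ := by
    have h1 := norm_sub_le b' b
    have h2 := hmin.2 b hfeas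
    linarith
  -- the residual is the series with coefficients `b' - b`
  have hres : ∀ x ∈ S j, HBExt.diffOp p (c j) (HBExt.synth (HBExt.freq lo hi e) d b') x - f j x
      = ∑' n, (HBExt.wt d n : ℂ) * (b' - b : lp (fun _ : ℕ => ℂ) 2) n * G n x := by
    intro x hx
    rw [← hu j x hx, ← ((hsum j b' x).sub (hsum j b x)).tsum_eq]
    refine tsum_congr fun n => ?_
    rw [lp.coeFn_sub, Pi.sub_apply]
    ring
  have hzero : ∀ z ∈ (X j : Set (HBExt.Euc m)),
      ∑' n, (HBExt.wt d n : ℂ) * (b' - b : lp (fun _ : ℕ => ℂ) 2) n * G n z = 0 := by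
    intro z hz
    rw [← hres z (hXS j hz), ← (hsum j b' z).tsum_eq, hmin.1 j z hz, sub_self]
  have hmain : ∀ k, ∀ α : Fin mj → ℕ, ∑ i, α i ≤ q → ∀ y ∈ U k,
      ‖HBExt.multiDeriv α (fun y =>
        HBExt.diffOp p (c j) (HBExt.synth (HBExt.freq lo hi e) d b') (σ k y) - f j (σ k y)) y‖ ≤
        2 * B₁ k * h ^ ((q : ℝ) - (mj : ℝ) / 2 - ((∑ i, α i : ℕ) : ℝ)) * ‖b‖ := by
    intro k α hα y hy
    have hpos : 0 < h := (hσ k).hmax_toReal_pos hmj htop ⟨y, hy⟩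
    rw [HBExt.multiDeriv_congr (hσ k).isOpen (fun y hy => hres _ ((hσ k).mapsTo hy)) α hy]
    refine ((hchart k (b' - b)).2 h hpos (hhh₀.trans (hh₀le k)) (X j) (hXS j)
      (fun x hx => HBExt.exists_dist_le_hmax htop j hx) hzero α hα y hy).trans ?_
    have hB := (hB₁ k).le
    calc _ ≤ B₁ k * (2 * ‖b‖) * h ^ ((q : ℝ) - (mj : ℝ) / 2 - ((∑ i, α i : ℕ) : ℝ)) := by
          gcongr
          exact HBExt.pow_sub_le_rpow hpos (hhh₀.trans hh₀1) hα mj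
      _ = _ := by ring
  refine ⟨fun k => ⟨?_, hmain k⟩, fun x hx => ?_⟩
  · exact (hchart k (b' - b)).1.congr fun y hy => hres _ ((hσ k).mapsTo hy)
  · -- the residual is continuous on `S j`, and is bounded on the images of the charts
    have hT : (⋃ k, σ k '' U k) ⊆ S j := Set.iUnion_subset fun k => (hσ k).mapsTo.image_subset
    have hcont : ContinuousOn (fun x =>
        HBExt.diffOp p (c j) (HBExt.synth (HBExt.freq lo hi e) d b') x - f j x) (S j) :=
      (HBExt.continuousOn_series hSV hd hG hF (b' - b)).congr hres
    have hmem := (((hcont x hx).mono hT).norm).mem_closure (hcover hx)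
      (t := Set.Iic ((1 + ∑ k, 2 * B₁ k) * h ^ ((q : ℝ) - (mj : ℝ) / 2) * ‖b‖)) ?_
    · rwa [closure_Iic] at hmem
    · intro z hz
      obtain ⟨k, y, hy, rfl⟩ := Set.mem_iUnion.mp hz
      have h1 := hmain k 0 (by simp) y hy
      rw [HBExt.multiDeriv_zero] at h1
      simp only [Pi.zero_apply, Finset.sum_const_zero, Nat.cast_zero, sub_zero] at h1
      refine h1.trans ?_
      have h2 : 2 * B₁ k ≤ 1 + ∑ k, 2 * B₁ k := by
        have := Finset.single_le_sum (f := fun k => 2 * B₁ k)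
          (fun k _ => (mul_pos two_pos (hB₁ k)).le) (Finset.mem_univ k)
        linarith
      have h3 : 0 ≤ h ^ ((q : ℝ) - (mj : ℝ) / 2) := Real.rpow_nonneg ENNReal.toReal_nonneg _
      exact mul_le_mul_of_nonneg_right (mul_le_mul_of_nonneg_right h2 h3) (norm_nonneg b)
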